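/- Let $V$ be a real vector space of finite even dimension $2n$, let $S^2V$ be the space of symmetric tensors on $V$, seen as the symmetric maps $V^*\to V$, and let $\mathcal Q=S^2V^*$ be the space of symmetric bilinear forms (quadrics) on $V$, seen as the symmetric maps $V\to V^*$. Let $S^2V^{>0}$ and $S^2V^{\ge 0}$ be the cones of positive and of semi-positive tensors. The pairing of $\mathcal Q$ and $S^2V$ is $q(p)=\mathrm{Tr}(q\circ p)$. For a linear subspace $P$ of $\mathcal Q$ of dimension $d$, that is, $P\in\mathrm{Gr}_d(\mathcal Q)$ (a pencil), let $P^\circ\subset S^2V$ be its annihilator. The pencil $P$ is *mixed* if $P^\circ\cap S^2V^{>0}\neq\emptyset$, and *regular* if all its non-zero elements are non-degenerate. A vector $v\in T_P\mathrm{Gr}_d(\mathcal Q)=\mathrm{Hom}(P,\mathcal Q/P)$ is *fitting* if its image contains the class of a positive definite form. Let $M$ be a connected smooth manifold of dimension $d$ (Hausdorff, second countable, without boundary). A smooth immersion $u:M\to\mathrm{Gr}_d(\mathcal Q)$ with mixed values is a *fitting immersion* if $du(v)$ is fitting for every non-zero tangent vector $v$ of $M$. A continuous map $u:M\to\mathrm{Gr}_d(\mathcal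 Q)$ with mixed values is a *globally fitting map* if the sets $\mathbb P(u(x)^\circ\cap S^2V^{\ge0})$, $x\in M$, are pairwise disjoint. Equip $\mathbb P(S^2V^{>0})$, the projective model of the symmetric space of $\mathrm{SL}(V)$, with its $\mathrm{SL}(V)$-invariant Riemannian metric. Fix a volume form on $V$. For a smooth immersion $h:M\to\mathbb P(S^2V^{>0})$, let $\bar h^*:M\to\mathcal Q$ be the map that sends $x$ to the positive definite form $B$ of determinant one with $h(x)=[B^{-1}]$. The *Gauss map* of $h$ is $\mathcal Gh:M\to\mathrm{Gr}_d(\mathcal Q)$, $\mathcal Gh(x)=d\bar h^*(T_xM)$. **Proposition 7.1.** Let $h:M\to\mathbb P(S^2V^{>0})$ be a totally geodesic smooth immersion such that the pencil $\mathcal Gh(x)$ is regular for every $x\in M$. Then $\mathcal Gh$ is a fitting immersion. If moreover $h$ is complete, that is, $M$ is complete for the Riemannian metric induced by $h$, then $\mathcal Gh$ is a globally fitting map. -/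

import Mathlib

open scoped Manifold ContDiff Topology LinearAlgebra.Projectivization

noncomputable section

/-! ## Symmetric tensors and quadrics -/

/-- Linear subspaces of a real normed space. -/
abbrev RealSubspace (E : Type*) [NormedAddCommGroup E] [NormedSpace ℝ E] : Type _ := Submodule ℝ E

/-- The space `𝒬 = S²V*` of symmetric bilinear forms (quadrics) on `V`, seen as the symmetric maps
`V → V*`. -/
def quadSubmodule (V : Type*) [NormedAddCommGroup V] [NormedSpace ℝ V] :
    RealSubspace (V →L[ℝ] StrongDual ℝ V) where
  carrier := {q | ∀ v w, q v w = q w v}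
  add_mem' := by
    intro a b ha hb v w
    simp [ha v w, hb v w]
  zero_mem' := by simp
  smul_mem' := by
    intro c a ha v w
    simp [ha v w]

/-- `𝒬 = S²V*`. -/
def Quad (V : Type*) [NormedAddCommGroup V] [NormedSpace ℝ V] : Type _ := quadSubmodule V

instance (V : Type*) [NormedAddCommGroup V] [NormedSpace ℝ V] : NormedAddCommGroup (Quad V) :=
  inferInstanceAs (NormedAddCommGroup (quadSubmodule V))

instance (V : Type*) [NormedAddCommGroup V] [NormedSpace ℝ V] : NormedSpace ℝ (Quad V) :=
  inferInstanceAs (NormedSpace ℝ (quadSubmodule V))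

/-- The underlying map `V → V*` of a quadric. -/
def Quad.toMap {V : Type*} [NormedAddCommGroup V] [NormedSpace ℝ V] :
    Quad V →L[ℝ] (V →L[ℝ] StrongDual ℝ V) := (quadSubmodule V).subtypeL

theorem Quad.toMap_injective {V : Type*} [NormedAddCommGroup V] [NormedSpace ℝ V] :
    Function.Injective (Quad.toMap (V := V)) := Subtype.val_injective

theorem Quad.symm {V : Type*} [NormedAddCommGroup V] [NormedSpace ℝ V] (q : Quad V) (v w : V) :
    Quad.toMap q v w = Quad.toMap q w v := q.2 v w

instance (V : Type*) [NormedAddCommGroup V] [NormedSpace ℝ V] [FiniteDimensional ℝ V] :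
    FiniteDimensional ℝ (Quad V) :=
  inferInstanceAs (FiniteDimensional ℝ (quadSubmodule V))

/-- The space `S²V` of symmetric tensors on `V`, seen as the symmetric maps `V* → V`. -/
def symTensorSubmodule (V : Type*) [NormedAddCommGroup V] [NormedSpace ℝ V] :
    RealSubspace (StrongDual ℝ V →L[ℝ] V) where
  carrier := {p | ∀ α β : StrongDual ℝ V, α (p β) = β (p α)}
  add_mem' := by
    intro a b ha hb v w
    simp [ha v w, hb v w]
  zero_mem' := by simp
  smul_mem' := by
    intro c a ha v w
    simp [ha v w]

/-- `S²V`. -/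
def SymTensor (V : Type*) [NormedAddCommGroup V] [NormedSpace ℝ V] : Type _ := symTensorSubmodule V

instance (V : Type*) [NormedAddCommGroup V] [NormedSpace ℝ V] : NormedAddCommGroup (SymTensor V) :=
  inferInstanceAs (NormedAddCommGroup (symTensorSubmodule V))

instance (V : Type*) [NormedAddCommGroup V] [NormedSpace ℝ V] : NormedSpace ℝ (SymTensor V) :=
  inferInstanceAs (NormedSpace ℝ (symTensorSubmodule V))

/-- The underlying map `V* → V` of a symmetric tensor. -/
def SymTensor.toMap {V : Type*} [NormedAddCommGroup V] [NormedSpace ℝ V] :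
    SymTensor V →L[ℝ] (StrongDual ℝ V →L[ℝ] V) := (symTensorSubmodule V).subtypeL

theorem SymTensor.toMap_injective {V : Type*} [NormedAddCommGroup V] [NormedSpace ℝ V] :
    Function.Injective (SymTensor.toMap (V := V)) := Subtype.val_injective

theorem SymTensor.symm {V : Type*} [NormedAddCommGroup V] [NormedSpace ℝ V]
    (p : SymTensor V) (α β : StrongDual ℝ V) :
    α (SymTensor.toMap p β) = β (SymTensor.toMap p α) := p.2 α β

instance (V : Type*) [NormedAddCommGroup V] [NormedSpace ℝ V] [FiniteDimensional ℝ V] :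
    FiniteDimensional ℝ (SymTensor V) :=
  inferInstanceAs (FiniteDimensional ℝ (symTensorSubmodule V))

section Algebra

variable {V : Type*} [NormedAddCommGroup V] [NormedSpace ℝ V]

/-- A quadric is positive if it is a positive definite bilinear form. -/
def Quad.IsPos (q : Quad V) : Prop := ∀ v : V, v ≠ 0 → 0 < Quad.toMap q v v

/-- A quadric is non-degenerate if it has trivial kernel. -/
def Quad.IsNondeg (q : Quad V) : Prop := ∀ v : V, Quad.toMap q v = 0 → v = 0

/-- The cone `S²V^{>0}` of positive tensors. -/
def SymTensor.IsPos (p : SymTensor V) : Prop :=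
  ∀ α : StrongDual ℝ V, α ≠ 0 → 0 < α (SymTensor.toMap p α)

/-- The cone `S²V^{≥0}` of semi-positive tensors. -/
def SymTensor.IsSemiPos (p : SymTensor V) : Prop :=
  ∀ α : StrongDual ℝ V, 0 ≤ α (SymTensor.toMap p α)

/-- The duality pairing `q(p) = Tr(q ∘ p)` (the trace of `p ∘ q : V → V` is the same number). -/
def quadPairing (q : Quad V) (p : SymTensor V) : ℝ :=
  LinearMap.trace ℝ V ((SymTensor.toMap p ∘L Quad.toMap q : V →L[ℝ] V) : V →ₗ[ℝ] V)

/-- `p` belongs to the annihilator `P° ⊆ S²V` of `P ⊆ 𝒬`. -/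
def InAnnihilator (P : Submodule ℝ (Quad V)) (p : SymTensor V) : Prop :=
  ∀ q ∈ P, quadPairing q p = 0

/-- The subset `ℙ(P° ∩ S²V^{≥0})` of `ℙ(S²V)`. -/
def projSlice (P : Submodule ℝ (Quad V)) : Set (ℙ ℝ (SymTensor V)) :=
  {l | ∃ p : SymTensor V, p ≠ 0 ∧ p ∈ l.submodule ∧ p.IsSemiPos ∧ InAnnihilator P p}

/-- A pencil is mixed if its annihilator contains a positive tensor. -/
def IsMixed (P : Submodule ℝ (Quad V)) : Prop :=
  ∃ p : SymTensor V, p.IsPos ∧ InAnnihilator P p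

/-- A pencil is regular if all its non-zero elements are non-degenerate. -/
def IsRegularPencil (P : Submodule ℝ (Quad V)) : Prop :=
  ∀ q ∈ P, q ≠ 0 → q.IsNondeg

/-- A vector `w ∈ T_P Gr_d(𝒬) = Hom(P, 𝒬/P)` is fitting if its image contains the class of a
positive quadric. -/
def IsFittingVector (P : Submodule ℝ (Quad V)) (w : P →ₗ[ℝ] (Quad V) ⧸ P) : Prop :=
  ∃ q : Quad V, q.IsPos ∧ P.mkQ q ∈ LinearMap.range w

/-! ## The projective model `ℙ(S²V^{>0})` of the symmetric space -/

variable (V) in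
/-- `ℙ(S²V^{>0})`, the set of lines of `S²V` that are spanned by a positive tensor. -/
def PosProj : Type _ :=
  {l : ℙ ℝ (SymTensor V) // ∃ p : SymTensor V, p ∈ l.submodule ∧ p.IsPos}

/-- The determinant of `q : V → V*` for the volume form that is equal to one on the basis `b`. -/
def gramDet {n : ℕ} (b : Module.Basis (Fin (2 * n)) ℝ V) (q : Quad V) : ℝ :=
  Matrix.det (Matrix.of fun i j => Quad.toMap q (b i) (b j))

/-- `q` is positive, of determinant one, and `[q⁻¹] = l`. -/
def IsUnimodularDual {n : ℕ} (b : Module.Basis (Fin (2 * n)) ℝ V) (l : PosProj V)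
    (q : Quad V) : Prop :=
  q.IsPos ∧ gramDet b q = 1 ∧ ∃ p : SymTensor V, p ∈ l.1.submodule ∧
    SymTensor.toMap p ∘L Quad.toMap q = ContinuousLinearMap.id ℝ V ∧
    Quad.toMap q ∘L SymTensor.toMap p = ContinuousLinearMap.id ℝ (StrongDual ℝ V)

theorem gramDet_smul {n : ℕ} (b : Module.Basis (Fin (2 * n)) ℝ V) (c : ℝ) (q : Quad V) :
    gramDet b (c • q) = c ^ (2 * n) * gramDet b q := by
  have : (Matrix.of fun i j => Quad.toMap (c • q) (b i) (b j)) =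
      c • (Matrix.of fun i j => Quad.toMap q (b i) (b j)) := by
    ext i j; simp
  rw [gramDet, this, Matrix.det_smul]; simp [gramDet]

theorem gramDet_pos {n : ℕ} (b : Module.Basis (Fin (2 * n)) ℝ V) {q : Quad V} (hq : q.IsPos) :
    0 < gramDet b q := by
  apply Matrix.PosDef.det_pos
  refine Matrix.PosDef.of_dotProduct_mulVec_pos ?_ ?_
  · ext i j
    simpa using Quad.symm q (b j) (b i)
  · intro x hx
    have hv : (∑ i, x i • b i) ≠ 0 := fun h =>
      hx (funext (Fintype.linearIndependent_iff.1 b.linearIndependent x h))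
    have := hq _ hv
    simp only [map_sum, map_smul, sum_apply, smul_apply,
      smul_eq_mul] at this
    simp only [dotProduct, Matrix.mulVec, Matrix.of_apply, star_trivial]
    refine lt_of_lt_of_eq this (Finset.sum_congr rfl fun i _ => ?_)
    rw [Finset.mul_sum, Finset.mul_sum]
    refine Finset.sum_congr rfl fun j _ => ?_
    rw [Quad.symm q (b i) (b j)]; ring

theorem SymTensor.IsPos.exists_inverse [FiniteDimensional ℝ V] {p : SymTensor V} (hp : p.IsPos) :
    ∃ q : Quad V, q.IsPos ∧ SymTensor.toMap p ∘L Quad.toMap q = ContinuousLinearMap.id ℝ V ∧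
      Quad.toMap q ∘L SymTensor.toMap p = ContinuousLinearMap.id ℝ (StrongDual ℝ V) := by
  have hinj : Function.Injective (SymTensor.toMap p : StrongDual ℝ V →ₗ[ℝ] V) := by
    rw [injective_iff_map_eq_zero]
    intro α hα
    by_contra h
    have := hp α h
    have h0 : SymTensor.toMap p α = 0 := hα
    simp [h0] at this
  have hfr : Module.finrank ℝ (StrongDual ℝ V) = Module.finrank ℝ V := by
    rw [← (LinearMap.toContinuousLinearMap (𝕜 := ℝ) (E := V) (F' := ℝ)).finrank_eq]
    exact Subspace.dual_finrank_eq
  let e := (LinearEquiv.ofInjectiveOfFinrankEq (SymTensor.toMap p : StrongDual ℝ V →ₗ[ℝ] V)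
    hinj hfr).toContinuousLinearEquiv
  have he : ∀ α, e α = SymTensor.toMap p α := fun α => rfl
  have h1 : ∀ v, SymTensor.toMap p (e.symm v) = v := fun v => by rw [← he]; simp
  have h2 : ∀ α, e.symm (SymTensor.toMap p α) = α := fun α => by rw [← he]; simp
  refine ⟨⟨e.symm.toContinuousLinearMap, fun v w => ?_⟩, fun v hv => ?_, ?_, ?_⟩
  · have := SymTensor.symm p (e.symm v) (e.symm w)
    rw [h1, h1] at this
    exact this
  · have := hp (e.symm v) (by simpa using hv)
    rw [h1] at this
    exact this
  · ext v; exact h1 v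
  · ext α : 1; exact h2 α

theorem existsUnique_isUnimodularDual [FiniteDimensional ℝ V] {n : ℕ}
    (b : Module.Basis (Fin (2 * n)) ℝ V) (l : PosProj V) :
    ∃! q : Quad V, IsUnimodularDual b l q := by
  obtain ⟨l, p, hpl, hp⟩ := l
  obtain ⟨q, hq, hpq, hqp⟩ := hp.exists_inverse
  have hn : n ≠ 0 := by
    rintro rfl
    have : Subsingleton V := by
      rw [← Module.finrank_zero_iff (R := ℝ), Module.finrank_eq_card_basis b]; simp
    exact l.rep_nonzero (Subtype.ext (by ext; exact Subsingleton.elim _ _))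
  have hn2 : 2 * n ≠ 0 := by omega
  have hdet := gramDet_pos b hq
  obtain ⟨c, hc, hcd⟩ : ∃ c : ℝ, 0 < c ∧ c ^ (2 * n) * gramDet b q = 1 := by
    refine ⟨(gramDet b q)⁻¹ ^ ((1 : ℝ) / ((2 * n : ℕ) : ℝ)), by positivity, ?_⟩
    rw [one_div, Real.rpow_inv_natCast_pow (by positivity) hn2]
    exact inv_mul_cancel₀ hdet.ne'
  refine ⟨c • q, ⟨fun v hv => ?_, by rw [gramDet_smul, hcd], c⁻¹ • p,
    Submodule.smul_mem _ _ hpl, ?_, ?_⟩, ?_⟩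
  · have := hq v hv
    simp only [map_smul, smul_apply, smul_eq_mul]
    positivity
  · ext v
    have := congrArg (fun f => f v) hpq
    simp_all [smul_smul, hc.ne']
  · ext α : 1
    have := congrArg (fun f => f α) hqp
    simp_all [smul_smul, hc.ne']
  · rintro q' ⟨hq', hd', p', hpl', hpq', hqp'⟩
    have hp0 : p ≠ 0 := by
      rintro rfl
      have hv : Nontrivial V := by
        rw [← Module.finrank_pos_iff (R := ℝ), Module.finrank_eq_card_basis b]; simp; omega
      obtain ⟨v, hv⟩ := exists_ne (0 : V)
      have := congrArg (fun f => f v) hpq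
      simp at this
      exact hv this.symm
    have hspan : l.submodule = Submodule.span ℝ {p} := by
      induction l using Projectivization.ind with
      | h x hx =>
        rw [Projectivization.submodule_mk] at hpl ⊢
        obtain ⟨a, rfl⟩ := Submodule.mem_span_singleton.1 hpl
        exact (Submodule.span_singleton_smul_eq
          (IsUnit.mk0 a (by rintro rfl; simp at hp0)) x).symm
    rw [hspan] at hpl'
    obtain ⟨a, rfl⟩ := Submodule.mem_span_singleton.1 hpl'
    have hqq : q = a • q' := by
      apply Subtype.ext
      ext v : 1
      have e1 : SymTensor.toMap p (Quad.toMap q v) = v := congrArg (fun f => f v) hpq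
      have e2 : Quad.toMap q' (SymTensor.toMap (a • p) (Quad.toMap q v)) = Quad.toMap q v := congrArg (fun f => f (Quad.toMap q v)) hqp'
      rw [map_smul, smul_apply, e1, map_smul] at e2
      exact e2.symm
    have hv : Nontrivial V := by
      rw [← Module.finrank_pos_iff (R := ℝ), Module.finrank_eq_card_basis b]; simp; omega
    obtain ⟨v, hv⟩ := exists_ne (0 : V)
    have ha : 0 < a := by
      have h1 := hq v hv
      have h2 := hq' v hv
      rw [hqq] at h1
      simp only [map_smul, smul_apply, smul_eq_mul] at h1
      exact (pos_iff_pos_of_mul_pos h1).2 h2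
    have hca : c * a = 1 := by
      rw [hqq, gramDet_smul, hd', mul_one, ← mul_pow] at hcd
      exact (pow_eq_one_iff_of_nonneg (by positivity) hn2).1 hcd
    rw [hqq, smul_smul, hca, one_smul]

/-- The unimodular representative of `[p⁻¹]`, for `[p] ∈ ℙ(S²V^{>0})`. The map `unimodularDual b`
identifies `ℙ(S²V^{>0})` with the smooth hypersurface of the positive quadrics of determinant one;
this gives `ℙ(S²V^{>0})` its smooth structure. -/
def unimodularDual [FiniteDimensional ℝ V] {n : ℕ} (b : Module.Basis (Fin (2 * n)) ℝ V)
    (l : PosProj V) : Quad V :=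
  (existsUnique_isUnimodularDual b l).choose

/-! ## The invariant Riemannian metric and its Levi-Civita connection -/

/-- The metric `g_B(q, r) = Tr(B⁻¹ q B⁻¹ r)` on the open cone of positive quadrics `B`. Restricted
to the positive quadrics of determinant one it is the `SL(V)`-invariant Riemannian metric of the
symmetric space. -/
def invMetric (B q r : Quad V) : ℝ :=
  LinearMap.trace ℝ V
    (((Quad.toMap B).inverse ∘L Quad.toMap q ∘L (Quad.toMap B).inverse ∘L Quad.toMap r :
      V →L[ℝ] V) : V →ₗ[ℝ] V)

/-- `ξ` is tangent at `B` to the hypersurface `det = det B`, that is, `d(log det)_B(ξ)` is zero. -/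
def IsUnimodularTangent (B ξ : Quad V) : Prop :=
  LinearMap.trace ℝ V (((Quad.toMap B).inverse ∘L Quad.toMap ξ : V →L[ℝ] V) : V →ₗ[ℝ] V) = 0

/-- The derivative at `B` of `B ↦ g_B(q, r)` in the direction `ξ`. -/
def invMetricDeriv (B ξ q r : Quad V) : ℝ :=
  fderiv ℝ (fun B' => invMetric B' q r) B ξ

/-- Koszul's formula in the linear coordinates of `𝒬`: the Christoffel symbol
`g_B(∇_q r, ξ)` of the Levi-Civita connection, for the constant vector fields `q` and `r`. -/
def christoffel (B q r ξ : Quad V) : ℝ :=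
  (invMetricDeriv B q r ξ + invMetricDeriv B r q ξ - invMetricDeriv B ξ q r) / 2

/-- `g(∇_{c'} c', ξ)` at time `t`: the pairing of the covariant acceleration of the curve `c` with
a vector `ξ`. If `c` and `ξ` are tangent to the positive quadrics of determinant one, it does not
matter whether the acceleration is taken there or in the cone. -/
def covAccel (c : ℝ → Quad V) (t : ℝ) (ξ : Quad V) : ℝ :=
  invMetric (c t) (deriv (deriv c) t) ξ + christoffel (c t) (deriv c t) (deriv c t) ξ

end Algebra

/-! ## The Grassmannian and its charts -/

section Grassmannian

variable {Q : Type*} [NormedAddCommGroup Q] [NormedSpace ℝ Q]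

variable (Q) in
/-- `Gr_d(Q)`, the set of the linear subspaces of dimension `d`. -/
def Gr (d : ℕ) : Type _ := {P : Submodule ℝ Q // Module.Finite ℝ P ∧ Module.finrank ℝ P = d}

/-- The graph `{x + f x | x ∈ P}` of a linear map `f : P → C`. -/
def graphOf {P C : Submodule ℝ Q} (f : P →L[ℝ] C) : Submodule ℝ Q :=
  LinearMap.range (P.subtype + C.subtype ∘ₗ (f : P →ₗ[ℝ] C))

theorem graphOf_injective {P C : Submodule ℝ Q} (hPC : IsCompl P C) {f g : P →L[ℝ] C}
    (h : graphOf f = graphOf g) : f = g := by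
  ext x : 1
  have hx : (x : Q) + f x ∈ graphOf g := h ▸ ⟨x, by simp⟩
  obtain ⟨y, hy⟩ := hx
  have hy' : (y : Q) + g y = x + f x := by simpa using hy
  have h1 : ((y - x : P) : Q) = ((f x - g y : C) : Q) := by
    push_cast
    rw [sub_eq_sub_iff_add_eq_add, hy', add_comm]
  have h2 : ((y - x : P) : Q) = 0 :=
    Submodule.disjoint_def.1 hPC.disjoint _ (y - x).2 (h1 ▸ (f x - g y).2)
  have h3 : y = x := sub_eq_zero.1 (Subtype.ext h2)
  rw [h2] at h1
  have h4 : f x - g y = 0 := Subtype.ext h1.symm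
  rw [sub_eq_zero.1 h4, h3]

open Classical in
/-- The chart of the Grassmannian given by a complement `C` of `P`: it sends a subspace `W`
transverse to `C` to the unique `f ∈ Hom(P, C)` with graph `W`. -/
def grCoord (P C W : Submodule ℝ Q) : P →L[ℝ] C :=
  if h : ∃ f : P →L[ℝ] C, graphOf f = W then h.choose else 0

variable {d : ℕ} {M : Type*} [TopologicalSpace M]

/-- Continuity of a map into the Grassmannian, in all the charts around `u x`. -/
def GrContinuousAt (u : M → Gr Q d) (x : M) : Prop :=
  ∀ C : Submodule ℝ Q, IsCompl (u x).1 C →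
    (∀ᶠ y in 𝓝 x, IsCompl (u y).1 C) ∧
      ContinuousAt (fun y => grCoord (u x).1 C (u y).1) x

variable [ChartedSpace (EuclideanSpace ℝ (Fin d)) M]

theorem finite_and_finrank_range {x : M} (f : TangentSpace (𝓡 d) x →L[ℝ] Q)
    (hf : Function.Injective f) :
    Module.Finite ℝ (LinearMap.range (f : TangentSpace (𝓡 d) x →ₗ[ℝ] Q)) ∧
      Module.finrank ℝ (LinearMap.range (f : TangentSpace (𝓡 d) x →ₗ[ℝ] Q)) = d := by
  have hfin : FiniteDimensional ℝ (TangentSpace (𝓡 d) x) :=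
    inferInstanceAs (FiniteDimensional ℝ (EuclideanSpace ℝ (Fin d)))
  have hd : Module.finrank ℝ (TangentSpace (𝓡 d) x) = d :=
    finrank_euclideanSpace_fin (𝕜 := ℝ) (n := d)
  exact ⟨inferInstance, (LinearMap.finrank_range_of_inj hf).trans hd⟩

/-- Smoothness of a map into the Grassmannian, in all the charts around `u x`. -/
def GrSmoothAt (u : M → Gr Q d) (x : M) : Prop :=
  ∀ C : Submodule ℝ Q, IsCompl (u x).1 C →
    (∀ᶠ y in 𝓝 x, IsCompl (u y).1 C) ∧
      ContMDiffAt (𝓡 d) 𝓘(ℝ, (u x).1 →L[ℝ] C) ∞ (fun y => grCoord (u x).1 C (u y).1) x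

/-- The derivative `du(v) ∈ T_{u x} Gr_d(Q) = Hom(u x, Q / u x)`, computed in the chart given by a
complement `C` of `u x` through `Hom(u x, C) ≃ Hom(u x, Q / u x)`. -/
def grDeriv (u : M → Gr Q d) (x : M) (C : Submodule ℝ Q) (v : TangentSpace (𝓡 d) x) :
    (u x).1 →ₗ[ℝ] Q ⧸ (u x).1 :=
  let D : TangentSpace (𝓡 d) x →L[ℝ] ((u x).1 →L[ℝ] C) :=
    mfderiv (𝓡 d) 𝓘(ℝ, (u x).1 →L[ℝ] C) (fun y => grCoord (u x).1 C (u y).1) x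
  (u x).1.mkQ ∘ₗ C.subtype ∘ₗ (D v : (u x).1 →ₗ[ℝ] C)

end Grassmannian

section Maps

variable {V : Type*} [NormedAddCommGroup V] [NormedSpace ℝ V]
  {d : ℕ} {M : Type*} [TopologicalSpace M]

/-- A globally fitting map: continuous, with values in the mixed pencils, and such that the sets
`ℙ(u(x)° ∩ S²V^{≥0})`, for `x ∈ M`, are pairwise disjoint. -/
structure IsGloballyFitting (u : M → Gr (Quad V) d) : Prop where
  continuousAt : ∀ x, GrContinuousAt u x
  mixed : ∀ x, IsMixed (u x).1
  disjoint : ∀ x y, x ≠ y → Disjoint (projSlice (u x).1) (projSlice (u y).1)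

variable [ChartedSpace (EuclideanSpace ℝ (Fin d)) M]

/-- A fitting immersion: a smooth immersion into the mixed pencils such that `du(v)` is fitting for
all non-zero tangent vectors `v`. -/
structure IsFittingImmersion (u : M → Gr (Quad V) d) : Prop where
  smoothAt : ∀ x, GrSmoothAt u x
  mixed : ∀ x, IsMixed (u x).1
  immersion : ∀ x C, IsCompl (u x).1 C → Function.Injective (grDeriv u x C)
  fitting : ∀ x C, IsCompl (u x).1 C → ∀ v : TangentSpace (𝓡 d) x, v ≠ 0 →
    IsFittingVector (u x).1 (grDeriv u x C v)

/-! ## Immersions into the symmetric space -/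

variable (d) [FiniteDimensional ℝ V] {n : ℕ} (b : Module.Basis (Fin (2 * n)) ℝ V)

/-- The lift of `h : M → ℙ(S²V^{>0})`, composed with `[X] ↦ [X⁻¹]`, to the positive quadrics of
determinant one. -/
def dualLift (h : M → PosProj V) (x : M) : Quad V := unimodularDual b (h x)

/-- The derivative at `x` of the dual lift of `h`. -/
def dualDeriv (h : M → PosProj V) (x : M) : TangentSpace (𝓡 d) x →L[ℝ] Quad V :=
  mfderiv (𝓡 d) 𝓘(ℝ, Quad V) (dualLift b h) x

/-- `h : M → ℙ(S²V^{>0})` is a smooth immersion. -/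
structure IsSymImmersion (h : M → PosProj V) : Prop where
  smooth : ContMDiff (𝓡 d) 𝓘(ℝ, Quad V) ∞ (dualLift b h)
  injective : ∀ x, Function.Injective (dualDeriv d b h x)

/-- The immersion `h` is totally geodesic: its second fundamental form is zero. As the second
fundamental form evaluated at `(γ', γ')` is the normal component of the covariant acceleration of
`h ∘ γ`, for every curve `γ` in `M`, this says that the acceleration of `h ∘ γ` is
orthogonal to every vector `ξ` tangent to the symmetric space and normal to `h`. -/
def IsTotallyGeodesic (h : M → PosProj V) : Prop :=
  ∀ (γ : ℝ → M) (t : ℝ), ContMDiffAt 𝓘(ℝ, ℝ) (𝓡 d) ∞ γ t →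
    ∀ ξ : Quad V, IsUnimodularTangent (dualLift b h (γ t)) ξ →
      (∀ v, invMetric (dualLift b h (γ t)) (dualDeriv d b h (γ t) v) ξ = 0) →
      covAccel (fun s => dualLift b h (γ s)) t ξ = 0

/-- `γ : ℝ → M` is a geodesic of the Riemannian metric induced by the immersion `h`: the component
tangent to `M` of the covariant acceleration of `h ∘ γ` is zero. -/
def IsInducedGeodesic (h : M → PosProj V) (γ : ℝ → M) : Prop :=
  ContMDiff 𝓘(ℝ, ℝ) (𝓡 d) ∞ γ ∧
    ∀ t, ∀ v, covAccel (fun s => dualLift b h (γ s)) t (dualDeriv d b h (γ t) v) = 0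

/-- The immersion `h` is complete: `M` is complete for the induced Riemannian metric, that is, every
tangent vector is the initial velocity of a geodesic that is defined for all times. -/
def IsCompleteImmersion (h : M → PosProj V) : Prop :=
  ∀ X : TangentBundle (𝓡 d) M, ∃ γ : ℝ → M, IsInducedGeodesic d b h γ ∧
    (⟨γ 0, mfderiv 𝓘(ℝ, ℝ) (𝓡 d) γ 0 (1 : ℝ)⟩ : TangentBundle (𝓡 d) M) = X

variable {d b} in
/-- The Gauss map of the immersion `h`: it sends `x` to the image of the derivative at `x` of the
dual lift of `h`. -/
def gaussMap {h : M → PosProj V} (hh : IsSymImmersion d b h) (x : M) : Gr (Quad V) d :=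
  ⟨LinearMap.range (dualDeriv d b h x : TangentSpace (𝓡 d) x →ₗ[ℝ] Quad V),
    finite_and_finrank_range (dualDeriv d b h x) (hh.injective x)⟩

end Maps

end

open scoped Manifold ContDiff Topology LinearAlgebra.Projectivization

set_option linter.unusedSectionVars false

/-! Write `B` for the dual lift of `h`, a map into the positive quadrics of determinant one, and
read quadrics as Gram matrices in `b`. Koszul's formula for the metric `Tr(B⁻¹ q B⁻¹ r)` gives a
curve `c` the covariant acceleration `c'' - c' c⁻¹ c'` (`covAccel_eq`). Total geodesy says exactly
that, for curves in the image of `h`, this acceleration lies in the Gauss pencil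
(`IsTotallyGeodesic.exists_accel`).

Fitting immersion. The derivative of the Gauss map in the direction `v` sends `dB(w)` to the class
of `D²B(v, w)`. Modulo the pencil, `D²B(v, v)` equals `q B⁻¹ q` with `q = dB(v)`. This form is
positive definite as soon as `q` is non-degenerate, which is where regularity enters
(`exists_pos_grDeriv_eq`). The pencils are mixed because `det B` is constant, so that `B⁻¹`
annihilates them. A positive form has positive pairing with `B⁻¹`, so its class is non-zero and the
Gauss map is an immersion.

Globally fitting. A geodesic of `M` is a geodesic of the ambient space: `c'' = c' c⁻¹ c'`. For a
non-zero semi-positive `p`, the derivative of `t ↦ Tr(p c'(t))` is the pairing of `p` with the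
positive form `c' c⁻¹ c'`, so this function is strictly increasing (`strictMono_quadPairing_deriv`).
If `p` annihilated the pencils at two distinct points joined by a geodesic, it would vanish at both
ends, a contradiction.

It remains to join any two points by a geodesic, a Hopf-Rinow statement
(`IsCompleteImmersion.exists_geodesic_joining`). Ambient geodesics are explicit, `B₀ exp(t B₀⁻¹ X)`,
and the ambient exponential map is an injective, proper immersion on symmetric matrices. Hence the
time-one map of `M` at a point is continuous, open and of closed range, so it is onto by
connectedness. -/

noncomputable section

open scoped Matrix.Norms.L2Operator Matrix

/-! ### Gram matrices, the trace pairing and its positivity -/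

section Gram

variable {V : Type*} [NormedAddCommGroup V] [NormedSpace ℝ V] [FiniteDimensional ℝ V]
  {ι : Type*} [Fintype ι] [DecidableEq ι]

/-- The Gram matrix of a quadric in a basis. -/
def gram (e : Module.Basis ι ℝ V) : Quad V →L[ℝ] Matrix ι ι ℝ :=
  LinearMap.toContinuousLinearMap
    { toFun := fun q => Matrix.of fun i j => Quad.toMap q (e i) (e j)
      map_add' := fun p q => by ext i j; simp
      map_smul' := fun c q => by ext i j; simp }

@[simp] theorem gram_apply (e : Module.Basis ι ℝ V) (q : Quad V) (i j : ι) :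
    gram e q i j = Quad.toMap q (e i) (e j) := rfl

theorem gram_transpose (e : Module.Basis ι ℝ V) (q : Quad V) : (gram e q)ᵀ = gram e q := by
  ext i j
  exact Quad.symm q (e j) (e i)

theorem toMap_eq_dotProduct (e : Module.Basis ι ℝ V) (q : Quad V) (v w : V) :
    Quad.toMap q v w = e.repr v ⬝ᵥ (gram e q *ᵥ e.repr w) := by
  conv_lhs => rw [← e.sum_repr v, ← e.sum_repr w]
  simp only [map_sum, map_smul, sum_apply, smul_apply, smul_eq_mul, dotProduct, Matrix.mulVec,
    gram_apply, Finset.mul_sum]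
  rw [Finset.sum_comm]
  refine Finset.sum_congr rfl fun i _ => Finset.sum_congr rfl fun j _ => ?_
  ring

theorem gram_injective (e : Module.Basis ι ℝ V) : Function.Injective (gram e) := by
  intro p q hpq
  apply Quad.toMap_injective
  ext v w
  rw [toMap_eq_dotProduct e, toMap_eq_dotProduct e, hpq]

theorem exists_gram_eq (e : Module.Basis ι ℝ V) {S : Matrix ι ι ℝ} (hS : Sᵀ = S) :
    ∃ q : Quad V, gram e q = S := by
  let L : V →L[ℝ] StrongDual ℝ V := LinearMap.toContinuousLinearMap
    ((LinearMap.toContinuousLinearMap (𝕜 := ℝ) (E := V) (F' := ℝ)).toLinearMap ∘ₗ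
      Matrix.toLinearMap₂ e e S)
  have hL : ∀ v w, L v w = Matrix.toLinearMap₂ e e S v w := fun v w => rfl
  have hs : ∀ v w, L v w = L w v := by
    intro v w
    rw [hL, hL, Matrix.toLinearMap₂_apply, Matrix.toLinearMap₂_apply, Finset.sum_comm]
    refine Finset.sum_congr rfl fun i _ => Finset.sum_congr rfl fun j _ => ?_
    have : S j i = S i j := congrFun (congrFun hS i) j
    simp only [smul_eq_mul, this]
    ring
  refine ⟨⟨L, hs⟩, ?_⟩
  ext i j
  change L (e i) (e j) = S i j
  rw [hL, Matrix.toLinearMap₂_apply_basis]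

theorem gram_posDef_iff (e : Module.Basis ι ℝ V) (q : Quad V) : (gram e q).PosDef ↔ q.IsPos := by
  constructor
  · intro h v hv
    rw [toMap_eq_dotProduct e]
    have := h.dotProduct_mulVec_pos (x := e.repr v) (by simpa using hv)
    simpa using this
  · intro h
    refine Matrix.PosDef.of_dotProduct_mulVec_pos (gram_transpose e q) fun x hx => ?_
    have hv : e.equivFun.symm x ≠ 0 := e.equivFun.symm.map_ne_zero_iff.2 hx
    have := h _ hv
    rw [toMap_eq_dotProduct e] at this
    have h2 : (e.repr (e.equivFun.symm x) : ι → ℝ) = x := e.equivFun.apply_symm_apply x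
    rwa [h2] at this

theorem gram_det_ne_zero {e : Module.Basis ι ℝ V} {q : Quad V} (hq : q.IsNondeg) :
    (gram e q).det ≠ 0 := by
  intro h
  obtain ⟨x, hx, h0⟩ := Matrix.exists_mulVec_eq_zero_iff.2 h
  have hv : e.equivFun.symm x ≠ 0 := e.equivFun.symm.map_ne_zero_iff.2 hx
  apply hv
  apply hq
  ext w
  have h2 : (e.repr (e.equivFun.symm x) : ι → ℝ) = x := e.equivFun.apply_symm_apply x
  rw [Quad.symm, toMap_eq_dotProduct e, h2, h0]
  simp

/-- The inverse of a continuous linear map is zero by convention when the map is not invertible, so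
the trace formulas for the metric need this before `inverse` can be read as a matrix inverse. -/
theorem Quad.isInvertible_of_det_ne_zero {e : Module.Basis ι ℝ V} {q : Quad V}
    (h : (gram e q).det ≠ 0) : (Quad.toMap q).IsInvertible := by
  have hinj : Function.Injective (Quad.toMap q : V →ₗ[ℝ] StrongDual ℝ V) := by
    rw [injective_iff_map_eq_zero]
    intro v hv
    have hv' : Quad.toMap q v = 0 := hv
    by_contra hne
    apply h
    rw [← Matrix.exists_mulVec_eq_zero_iff]
    refine ⟨e.repr v, by simpa using hne, ?_⟩
    ext i
    have h1 := toMap_eq_dotProduct e q (e i) v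
    rw [Quad.symm, hv'] at h1
    simpa [Finsupp.single_apply, dotProduct] using h1.symm
  have hfr : Module.finrank ℝ V = Module.finrank ℝ (StrongDual ℝ V) := by
    rw [← (LinearMap.toContinuousLinearMap (𝕜 := ℝ) (E := V) (F' := ℝ)).finrank_eq]
    exact Subspace.dual_finrank_eq.symm
  exact ⟨(LinearEquiv.ofInjectiveOfFinrankEq (Quad.toMap q : V →ₗ[ℝ] StrongDual ℝ V)
    hinj hfr).toContinuousLinearEquiv, by ext; rfl⟩

theorem toMatrix_inverse_comp {e : Module.Basis ι ℝ V} {B : Quad V} (h : (gram e B).det ≠ 0)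
    (q : Quad V) :
    LinearMap.toMatrix e e
      (((Quad.toMap B).inverse ∘L Quad.toMap q : V →L[ℝ] V) : V →ₗ[ℝ] V) =
      (gram e B)⁻¹ * gram e q := by
  have hB := Quad.isInvertible_of_det_ne_zero h
  set f : V →L[ℝ] V := (Quad.toMap B).inverse ∘L Quad.toMap q with hf
  have h1 : ∀ v, Quad.toMap B (f v) = Quad.toMap q v := fun v =>
    hB.self_apply_inverse _
  have h2 : gram e B * LinearMap.toMatrix e e (f : V →ₗ[ℝ] V) = gram e q := by
    ext i j
    have h3 : Quad.toMap q (e i) (e j) = Quad.toMap B (e i) (f (e j)) := by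
      rw [Quad.symm, ← h1, Quad.symm]
    rw [gram_apply, h3, toMap_eq_dotProduct e]
    simp [Matrix.mul_apply, LinearMap.toMatrix_apply, Finsupp.single_apply, dotProduct,
      Matrix.mulVec]
  rw [← h2, ← Matrix.mul_assoc, Matrix.nonsing_inv_mul _ (isUnit_iff_ne_zero.2 h), Matrix.one_mul]

theorem trace_inverse_comp {e : Module.Basis ι ℝ V} {B : Quad V} (h : (gram e B).det ≠ 0)
    (q : Quad V) :
    LinearMap.trace ℝ V (((Quad.toMap B).inverse ∘L Quad.toMap q : V →L[ℝ] V) : V →ₗ[ℝ] V) =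
      ((gram e B)⁻¹ * gram e q).trace := by
  rw [LinearMap.trace_eq_matrix_trace ℝ e, toMatrix_inverse_comp h]

theorem invMetric_eq {e : Module.Basis ι ℝ V} {B : Quad V} (h : (gram e B).det ≠ 0)
    (q r : Quad V) :
    invMetric B q r = ((gram e B)⁻¹ * gram e q * ((gram e B)⁻¹ * gram e r)).trace := by
  rw [invMetric, LinearMap.trace_eq_matrix_trace ℝ e, ← toMatrix_inverse_comp h,
    ← toMatrix_inverse_comp h, ← LinearMap.toMatrix_comp]
  rfl

/-- The matrix of a symmetric tensor in the dual basis. -/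
def tensorMatrix (e : Module.Basis ι ℝ V) (p : SymTensor V) : Matrix ι ι ℝ :=
  Matrix.of fun i j => (e.coord i) (SymTensor.toMap p (LinearMap.toContinuousLinearMap (e.coord j)))

theorem quadPairing_eq_trace (e : Module.Basis ι ℝ V) (q : Quad V) (p : SymTensor V) :
    quadPairing q p = (tensorMatrix e p * gram e q).trace := by
  rw [quadPairing, LinearMap.trace_eq_matrix_trace ℝ e]
  congr 1
  ext i j
  have h : Quad.toMap q (e j) =
      ∑ k, gram e q k j • LinearMap.toContinuousLinearMap (e.coord k) := by
    ext w
    rw [toMap_eq_dotProduct e]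
    simp [Matrix.mulVec, dotProduct, Finsupp.single_apply, sum_apply, Quad.symm q (e j)]
  rw [LinearMap.toMatrix_apply]
  change e.repr (SymTensor.toMap p (Quad.toMap q (e j))) i = _
  rw [h, map_sum, map_sum, Finsupp.finsetSum_apply, Matrix.mul_apply]
  refine Finset.sum_congr rfl fun k _ => ?_
  simp [tensorMatrix, mul_comm]

theorem tensorMatrix_quadForm (e : Module.Basis ι ℝ V) (p : SymTensor V) (x : ι → ℝ) :
    x ⬝ᵥ (tensorMatrix e p *ᵥ x) =
      (∑ i, x i • LinearMap.toContinuousLinearMap (e.coord i) : StrongDual ℝ V)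
        (SymTensor.toMap p (∑ i, x i • LinearMap.toContinuousLinearMap (e.coord i))) := by
  simp only [map_sum, map_smul, sum_apply, smul_apply, smul_eq_mul, dotProduct, Matrix.mulVec,
    Finset.mul_sum, tensorMatrix, Matrix.of_apply, LinearMap.coe_toContinuousLinearMap']
  rw [Finset.sum_comm]
  refine Finset.sum_congr rfl fun i _ => Finset.sum_congr rfl fun j _ => ?_
  ring

theorem tensorMatrix_posSemidef (e : Module.Basis ι ℝ V) {p : SymTensor V} (hp : p.IsSemiPos) :
    (tensorMatrix e p).PosSemidef := by
  refine Matrix.PosSemidef.of_dotProduct_mulVec_nonneg ?_ fun x => ?_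
  · ext i j
    exact SymTensor.symm p (LinearMap.toContinuousLinearMap (e.coord j))
      (LinearMap.toContinuousLinearMap (e.coord i))
  · rw [star_trivial, tensorMatrix_quadForm]
    exact hp _

theorem tensorMatrix_eq_zero (e : Module.Basis ι ℝ V) {p : SymTensor V}
    (h : tensorMatrix e p = 0) : p = 0 := by
  apply SymTensor.toMap_injective
  rw [map_zero]
  have hd : ∀ α : StrongDual ℝ V, α = ∑ i, α (e i) • LinearMap.toContinuousLinearMap (e.coord i) := by
    intro α
    ext v
    conv_lhs => rw [← e.sum_repr v]
    simp only [map_sum, map_smul, sum_apply, smul_apply, smul_eq_mul,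
      LinearMap.coe_toContinuousLinearMap', Module.Basis.coord_apply, mul_comm]
  ext α
  rw [hd α, map_sum]
  refine Finset.sum_eq_zero fun i _ => ?_
  rw [map_smul]
  convert smul_zero _
  apply e.repr.injective
  ext j
  have := congrFun (congrFun h j) i
  simpa [tensorMatrix] using this

theorem SymTensor.IsPos.isSemiPos {p : SymTensor V} (hp : p.IsPos) : p.IsSemiPos := by
  intro α
  by_cases h : α = 0
  · simp [h]
  · exact (hp α h).le

-- A factor `R` replaces the square root of a positive matrix: congruence by `R⁻¹` moves the base
-- point to the identity, where symmetric matrices and the spectral theorem apply.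
open scoped MatrixOrder in
theorem exists_conjTranspose_mul_self {A : Matrix ι ι ℝ} (hA : A.PosDef) :
    ∃ R : Matrix ι ι ℝ, A = Rᴴ * R ∧ IsUnit R := by
  obtain ⟨R, hR⟩ := CStarAlgebra.nonneg_iff_eq_star_mul_self.1 hA.posSemidef.nonneg
  refine ⟨R, hR, ?_⟩
  have hu : IsUnit A := hA.isUnit
  rw [hR, Matrix.isUnit_iff_isUnit_det, Matrix.det_mul] at hu
  rw [Matrix.isUnit_iff_isUnit_det]
  exact isUnit_of_mul_isUnit_right hu

/-- With `Q = Rᵀ R`, the pairing is the trace of the positive semidefinite matrix `R P Rᵀ`, which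
vanishes only if the matrix does. Both halves of the theorem rest on this positivity. -/
theorem quadPairing_pos {q : Quad V} (hq : q.IsPos) {p : SymTensor V} (hp : p.IsSemiPos)
    (hp0 : p ≠ 0) : 0 < quadPairing q p := by
  classical
  let e := Module.finBasis ℝ V
  have hQ := (gram_posDef_iff e q).2 hq
  have hP := tensorMatrix_posSemidef e hp
  obtain ⟨R, hR, hR'⟩ := exists_conjTranspose_mul_self hQ
  rw [quadPairing_eq_trace e, hR, ← Matrix.mul_assoc, Matrix.trace_mul_comm, ← Matrix.mul_assoc]
  have hS : (R * tensorMatrix e p * Rᴴ).PosSemidef := hP.mul_mul_conjTranspose_same R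
  refine lt_of_le_of_ne hS.trace_nonneg fun h0 => hp0 (tensorMatrix_eq_zero e ?_)
  have h1 := hS.trace_eq_zero_iff.1 h0.symm
  have hR2 : IsUnit Rᴴ := by
    rw [← Matrix.star_eq_conjTranspose]; exact hR'.star
  rw [Matrix.mul_assoc, hR'.mul_right_eq_zero, hR2.mul_left_eq_zero] at h1
  exact h1

end Gram

/-! ### Derivatives of the inverse and of the determinant -/

section MatrixCalculus

variable {ι : Type*} [Fintype ι] [DecidableEq ι]

theorem Matrix.hasFDerivAt_inv {G : Matrix ι ι ℝ} (hG : G.det ≠ 0) :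
    HasFDerivAt (fun A : Matrix ι ι ℝ => A⁻¹)
      (-ContinuousLinearMap.mulLeftRight ℝ (Matrix ι ι ℝ) G⁻¹ G⁻¹) G := by
  obtain ⟨u, rfl⟩ := (Matrix.isUnit_iff_isUnit_det G).2 (isUnit_iff_ne_zero.2 hG)
  have h := hasFDerivAt_ringInverse (𝕜 := ℝ) u
  have h1 : (fun A : Matrix ι ι ℝ => A⁻¹) = Ring.inverse := by
    funext A
    exact Matrix.nonsing_inv_eq_ringInverse A
  have h2 : ((u : Matrix ι ι ℝ))⁻¹ = ((u⁻¹ : (Matrix ι ι ℝ)ˣ) : Matrix ι ι ℝ) := by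
    rw [Matrix.nonsing_inv_eq_ringInverse, Ring.inverse_unit]
  rw [h1, h2]
  exact h

theorem HasDerivAt.matrix_inv {C : ℝ → Matrix ι ι ℝ} {C' : Matrix ι ι ℝ} {t : ℝ}
    (h : HasDerivAt C C' t) (hd : (C t).det ≠ 0) :
    HasDerivAt (fun s => (C s)⁻¹) (-((C t)⁻¹ * C' * (C t)⁻¹)) t := by
  have := (Matrix.hasFDerivAt_inv hd).comp_hasDerivAt t h
  simp only [neg_apply, ContinuousLinearMap.mulLeftRight_apply] at this
  exact this

theorem Matrix.differentiable_det : Differentiable ℝ (fun A : Matrix ι ι ℝ => A.det) := by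
  simp only [Matrix.det_apply]
  have h : ∀ i j, Differentiable ℝ (fun A : Matrix ι ι ℝ => A i j) := fun i j =>
    (LinearMap.toContinuousLinearMap (Matrix.entryLinearMap ℝ ℝ i j)).differentiable
  fun_prop

theorem Matrix.fderiv_det_one (A : Matrix ι ι ℝ) :
    fderiv ℝ (fun A : Matrix ι ι ℝ => A.det) 1 A = A.trace := by
  have h1 : HasDerivAt (fun s : ℝ => (1 + s • A).det)
      (fderiv ℝ (fun A : Matrix ι ι ℝ => A.det) 1 A) 0 := by
    have h2 : HasDerivAt (fun s : ℝ => 1 + s • A) A 0 := by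
      simpa using ((hasDerivAt_id (0 : ℝ)).smul_const A).const_add (1 : Matrix ι ι ℝ)
    have h3 : HasFDerivAt (fun A : Matrix ι ι ℝ => A.det)
      (fderiv ℝ (fun A : Matrix ι ι ℝ => A.det) 1) (1 + (0 : ℝ) • A) := by
      simpa using (Matrix.differentiable_det 1).hasFDerivAt
    exact h3.comp_hasDerivAt (0 : ℝ) h2
  have h4 := (Matrix.det (1 + (Polynomial.X : Polynomial ℝ) • A.map Polynomial.C)).hasDerivAt 0
  rw [Matrix.derivative_det_one_add_X_smul] at h4
  refine h1.unique (h4.congr_of_eventuallyEq (Filter.Eventually.of_forall fun s => ?_))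
  simp only []
  rw [← Polynomial.coe_evalRingHom, RingHom.map_det]
  congr 1
  ext i j
  simp [Matrix.one_apply, apply_ite]
  ring

/-- Multiplying by the fixed matrix `(C t)⁻¹` moves the curve through the identity, where the
derivative of the determinant is the trace. -/
theorem trace_inv_mul_deriv_eq_zero {C : ℝ → Matrix ι ι ℝ} {C' : Matrix ι ι ℝ} {t c : ℝ}
    (h : HasDerivAt C C' t) (hd : (C t).det ≠ 0) (hc : ∀ᶠ s in 𝓝 t, (C s).det = c) :
    ((C t)⁻¹ * C').trace = 0 := by
  have h1 : HasDerivAt (fun s => (C t)⁻¹ * C s) ((C t)⁻¹ * C') t := h.const_mul _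
  have h2 : HasFDerivAt (fun A : Matrix ι ι ℝ => A.det)
      (fderiv ℝ (fun A : Matrix ι ι ℝ => A.det) 1) ((C t)⁻¹ * C t) := by
    rw [Matrix.nonsing_inv_mul _ (isUnit_iff_ne_zero.2 hd)]
    exact (Matrix.differentiable_det 1).hasFDerivAt
  have h3 := h2.comp_hasDerivAt t h1
  rw [Matrix.fderiv_det_one] at h3
  have h4 : HasDerivAt (fun s => ((C t)⁻¹ * C s).det) 0 t := by
    refine (hasDerivAt_const t ((C t)⁻¹.det * c)).congr_of_eventuallyEq ?_
    filter_upwards [hc] with s hs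
    rw [Matrix.det_mul, hs]
  exact h3.unique h4

/-- The trace as a continuous linear functional. -/
def Matrix.traceL : Matrix ι ι ℝ →L[ℝ] ℝ :=
  LinearMap.toContinuousLinearMap (Matrix.traceLinearMap ι ℝ ℝ)

@[simp] theorem Matrix.traceL_apply (A : Matrix ι ι ℝ) : Matrix.traceL A = A.trace := rfl

end MatrixCalculus

/-! ### The Levi-Civita connection in matrix form -/

section CovariantAcceleration

variable {V : Type*} [NormedAddCommGroup V] [NormedSpace ℝ V] [FiniteDimensional ℝ V]
  {ι : Type*} [Fintype ι] [DecidableEq ι]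

theorem invMetricDeriv_eq {e : Module.Basis ι ℝ V} {B : Quad V} (h : (gram e B).det ≠ 0)
    (ξ q r : Quad V) :
    invMetricDeriv B ξ q r =
      -((gram e B)⁻¹ * gram e ξ * (gram e B)⁻¹ * gram e q * ((gram e B)⁻¹ * gram e r)).trace
      -((gram e B)⁻¹ * gram e q * ((gram e B)⁻¹ * gram e ξ * (gram e B)⁻¹ * gram e r)).trace := by
  have hne : ∀ᶠ B' in 𝓝 B, (gram e B').det ≠ 0 :=
    (Matrix.differentiable_det.continuous.comp (gram e).continuous).continuousAt.eventually_ne h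
  -- The matrix formula is available only where the Gram determinant is non-zero; this is an open
  -- condition, so the germ at `B` suffices for the derivative.
  have heq : (fun B' => invMetric B' q r) =ᶠ[𝓝 B] fun B' =>
      ((gram e B')⁻¹ * gram e q * ((gram e B')⁻¹ * gram e r)).trace := by
    filter_upwards [hne] with B' hB'
    exact invMetric_eq hB' q r
  have hdiff : DifferentiableAt ℝ (fun B' => invMetric B' q r) B := by
    refine DifferentiableAt.congr_of_eventuallyEq ?_ heq
    have h1 : DifferentiableAt ℝ (fun B' => (gram e B')⁻¹) B :=
      (Matrix.hasFDerivAt_inv h).differentiableAt.comp B (gram e).differentiableAt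
    exact DifferentiableAt.comp (g := Matrix.traceL) B Matrix.traceL.differentiableAt
      ((h1.mul_const (gram e q)).mul (h1.mul_const (gram e r)))
  have hline : HasDerivAt (fun s : ℝ => B + s • ξ) ξ 0 := by
    simpa using ((hasDerivAt_id (0 : ℝ)).smul_const ξ).const_add B
  have hB0 : B + (0 : ℝ) • ξ = B := by simp
  have h1 : HasDerivAt (fun s : ℝ => invMetric (B + s • ξ) q r) (invMetricDeriv B ξ q r) 0 := by
    refine HasFDerivAt.comp_hasDerivAt (0 : ℝ) (l := fun B' => invMetric B' q r) ?_ hline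
    rw [hB0]
    exact hdiff.hasFDerivAt
  have hC : HasDerivAt (fun s : ℝ => gram e (B + s • ξ)) (gram e ξ) 0 :=
    (gram e).hasFDerivAt.comp_hasDerivAt (0 : ℝ) hline
  have hCi := hC.matrix_inv (by rwa [hB0])
  rw [hB0] at hCi
  have h2 := Matrix.traceL.hasFDerivAt.comp_hasDerivAt (0 : ℝ)
    ((hCi.mul_const (gram e q)).mul (hCi.mul_const (gram e r)))
  have h3 := h1.unique (h2.congr_of_eventuallyEq (by
    have := (hline.continuousAt.tendsto).eventually (by rw [hB0]; exact heq)
    exact this))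
  rw [h3, hB0]
  simp only [Matrix.traceL_apply, Matrix.trace_add, neg_mul, mul_neg, Matrix.trace_neg]
  ring

/-- By cyclicity of the trace, each of the three terms of Koszul's formula is `-2T`, where `T` is
the trace on the right; the signs `+ + -` and the factor `1/2` leave `-T`. -/
theorem christoffel_eq {e : Module.Basis ι ℝ V} {B : Quad V} (h : (gram e B).det ≠ 0)
    (q ξ : Quad V) :
    christoffel B q q ξ =
      -((gram e B)⁻¹ * (gram e q * (gram e B)⁻¹ * gram e q) * ((gram e B)⁻¹ * gram e ξ)).trace := by
  rw [christoffel, invMetricDeriv_eq h, invMetricDeriv_eq h]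
  have h1 := Matrix.trace_mul_comm ((gram e B)⁻¹ * gram e q)
    ((gram e B)⁻¹ * gram e ξ * (gram e B)⁻¹ * gram e q)
  have h2 := Matrix.trace_mul_comm ((gram e B)⁻¹ * gram e ξ)
    ((gram e B)⁻¹ * gram e q * (gram e B)⁻¹ * gram e q)
  simp only [Matrix.mul_assoc] at h1 h2 ⊢
  rw [h1, h2]
  ring

/-- The correction to `c''` is the form `c' c⁻¹ c'`, whose positivity is the heart of the argument.
-/
theorem covAccel_eq {e : Module.Basis ι ℝ V} {c : ℝ → Quad V} {t : ℝ}
    (h : (gram e (c t)).det ≠ 0) (ξ : Quad V) :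
    covAccel c t ξ = ((gram e (c t))⁻¹ *
      (gram e (deriv (deriv c) t) - gram e (deriv c t) * (gram e (c t))⁻¹ * gram e (deriv c t)) *
      ((gram e (c t))⁻¹ * gram e ξ)).trace := by
  rw [covAccel, invMetric_eq h, christoffel_eq h, Matrix.mul_sub, Matrix.sub_mul, Matrix.trace_sub]
  ring

end CovariantAcceleration

/-! ### The exponential of symmetric matrices and the geodesic equation -/

theorem Real.one_add_sq_div_two_le_cosh (x : ℝ) : 1 + x ^ 2 / 2 ≤ Real.cosh x := by
  have h1 : Real.cosh x = 1 + 2 * Real.sinh (x / 2) ^ 2 := by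
    have := Real.cosh_two_mul (x / 2)
    rw [Real.cosh_sq, mul_div_cancel₀ x two_ne_zero] at this
    rw [this]
    ring
  have h2 : (x / 2) ^ 2 ≤ Real.sinh (x / 2) ^ 2 := by
    rcases le_total 0 (x / 2) with h | h
    · exact pow_le_pow_left₀ h (Real.self_le_sinh_iff.2 h) 2
    · have := Real.sinh_le_self_iff.2 h
      nlinarith
  rw [h1]
  linarith

section MatrixExp

variable {ι : Type*} [Fintype ι] [DecidableEq ι]

theorem Matrix.exists_orthogonal_diagonalization {A : Matrix ι ι ℝ} (hA : Aᵀ = A) :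
    ∃ (U W : Matrix ι ι ℝ) (l : ι → ℝ), U * W = 1 ∧ W * U = 1 ∧
      ∀ t : ℝ, A = U * Matrix.diagonal l * W ∧
        NormedSpace.exp (t • A) = U * Matrix.diagonal (fun i => Real.exp (t * l i)) * W := by
  have hH : A.IsHermitian := hA
  let u : (Matrix ι ι ℝ)ˣ := Unitary.toUnits hH.eigenvectorUnitary
  have hs : A = (u : Matrix ι ι ℝ) * Matrix.diagonal hH.eigenvalues * (u⁻¹ : (Matrix ι ι ℝ)ˣ) := by
    have := hH.spectral_theorem
    rw [Unitary.conjStarAlgAut_apply] at this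
    exact this
  refine ⟨u, (u⁻¹ : (Matrix ι ι ℝ)ˣ), hH.eigenvalues, u.mul_inv, u.inv_mul, fun t => ⟨hs, ?_⟩⟩
  have h1 : t • A = (u : Matrix ι ι ℝ) * Matrix.diagonal (t • hH.eigenvalues) *
      (u⁻¹ : (Matrix ι ι ℝ)ˣ) := by
    conv_lhs => rw [hs]
    rw [Matrix.diagonal_smul, Matrix.mul_smul, Matrix.smul_mul]
  rw [h1, Matrix.exp_units_conj, Matrix.exp_diagonal]
  congr 3
  funext i
  rw [Pi.coe_exp, Real.exp_eq_exp_ℝ]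
  rfl

/-- Summed over the eigenvalues, this is `2 cosh l ≥ 2 + l²`. It bounds `A` by its exponential and
the inverse of it, which serves for injectivity of `exp` and later for properness of the exponential
map. -/
theorem Matrix.trace_exp_add_trace_exp_neg_ge {A : Matrix ι ι ℝ} (hA : Aᵀ = A) :
    2 * (Fintype.card ι : ℝ) + (A * A).trace ≤
      (NormedSpace.exp A).trace + (NormedSpace.exp (-A)).trace := by
  obtain ⟨U, W, l, hUW, hWU, h⟩ := Matrix.exists_orthogonal_diagonalization hA
  have htr : ∀ D : Matrix ι ι ℝ, (U * D * W).trace = D.trace := fun D => by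
    rw [Matrix.mul_assoc, Matrix.trace_mul_comm, Matrix.mul_assoc, hWU, Matrix.mul_one]
  have h1 := (h 1).2
  have h2 := (h (-1)).2
  have h3 : A * A = U * Matrix.diagonal (fun i => l i * l i) * W := by
    rw [(h 1).1, ← Matrix.diagonal_mul_diagonal]
    simp only [Matrix.mul_assoc]
    rw [← Matrix.mul_assoc W U, hWU, Matrix.one_mul]
  rw [one_smul] at h1
  rw [neg_smul, one_smul] at h2
  rw [h1, h2, h3, htr, htr, htr, Matrix.trace_diagonal, Matrix.trace_diagonal,
    Matrix.trace_diagonal, ← Finset.sum_add_distrib]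
  have h4 : 2 * (Fintype.card ι : ℝ) = ∑ _i : ι, (2 : ℝ) := by simp [mul_comm]
  rw [h4, ← Finset.sum_add_distrib]
  refine Finset.sum_le_sum fun i _ => ?_
  have h5 := Real.cosh_eq (l i)
  have h6 : 1 + (l i) ^ 2 / 2 ≤ Real.cosh (l i) := Real.one_add_sq_div_two_le_cosh _
  rw [one_mul, neg_one_mul]
  nlinarith

/-- In an eigenbasis of `A`, commuting with the exponential means that each entry of `H` is zero or
joins two eigenvalues with equal exponentials, which are then equal. -/
theorem Matrix.commute_of_commute_exp {A H : Matrix ι ι ℝ} (hA : Aᵀ = A)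
    (h : Commute (NormedSpace.exp A) H) : Commute A H := by
  obtain ⟨U, W, l, hUW, hWU, hD⟩ := Matrix.exists_orthogonal_diagonalization hA
  have h1 := (hD 1).2
  rw [one_smul] at h1
  have key : ∀ D : Matrix ι ι ℝ, Commute (U * D * W) H ↔ Commute D (W * H * U) := by
    intro D
    constructor
    · intro hc
      have := congrArg (fun X => W * X * U) hc.eq
      simp only [Matrix.mul_assoc] at this
      rw [← Matrix.mul_assoc W U, hWU, Matrix.one_mul, Matrix.mul_one] at this
      change D * (W * H * U) = W * H * U * D
      simp only [Matrix.mul_assoc]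
      exact this
    · intro hc
      have := congrArg (fun X => U * X * W) hc.eq
      simp only [Matrix.mul_assoc] at this
      rw [← Matrix.mul_assoc U W, hUW, Matrix.one_mul, Matrix.mul_one] at this
      change U * D * W * H = H * (U * D * W)
      simp only [Matrix.mul_assoc]
      exact this
  rw [h1, key] at h
  rw [(hD 1).1, key]
  ext i j
  have hij := congrFun (congrFun h.eq i) j
  rw [Matrix.diagonal_mul, Matrix.mul_diagonal, one_mul, one_mul] at hij
  rw [Matrix.diagonal_mul, Matrix.mul_diagonal]
  by_cases h0 : (W * H * U) i j = 0
  · rw [h0]; simp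
  · rw [mul_comm] at hij
    rw [Real.exp_injective (mul_left_cancel₀ h0 hij)]
    ring

theorem Matrix.eq_zero_of_transpose_eq_of_trace_sq_le {A : Matrix ι ι ℝ} (hA : Aᵀ = A)
    (h : (A * A).trace ≤ 0) : A = 0 := by
  have h1 : (Aᴴ * A).trace = 0 := by
    have hH : Aᴴ = A := hA
    refine le_antisymm (by rwa [hH]) ?_
    exact (Matrix.posSemidef_conjTranspose_mul_self A).trace_nonneg
  exact Matrix.trace_conjTranspose_mul_self_eq_zero_iff.1 h1

/-- The two matrices commute, so `exp (A - A')` and its inverse are both the identity; the trace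
inequality then forces `Tr (A - A')² ≤ 0`. -/
theorem Matrix.exp_injOn_symm {A A' : Matrix ι ι ℝ} (hA : Aᵀ = A) (hA' : A'ᵀ = A')
    (h : NormedSpace.exp A = NormedSpace.exp A') : A = A' := by
  have h1 : Commute A A' := by
    apply Matrix.commute_of_commute_exp hA
    rw [h]
    exact ((Commute.refl A').exp_left)
  have h2 : NormedSpace.exp (A - A') = 1 := by
    rw [sub_eq_add_neg, Matrix.exp_add_of_commute _ _ h1.neg_right, h,
      ← Matrix.exp_add_of_commute _ _ (Commute.refl A').neg_right, add_neg_cancel,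
      NormedSpace.exp_zero]
  have h3 : NormedSpace.exp (-(A - A')) = 1 := by
    rw [Matrix.exp_neg, h2, inv_one]
  have hs : (A - A')ᵀ = A - A' := by rw [Matrix.transpose_sub, hA, hA']
  have h4 := Matrix.trace_exp_add_trace_exp_neg_ge hs
  rw [h2, h3, Matrix.trace_one] at h4
  exact sub_eq_zero.1 (Matrix.eq_zero_of_transpose_eq_of_trace_sq_le hs (by linarith))

theorem Matrix.contDiff_exp : ContDiff ℝ ∞ (NormedSpace.exp : Matrix ι ι ℝ → Matrix ι ι ℝ) :=
  contDiff_iff_contDiffAt.2 fun A => (NormedSpace.exp_analytic A).contDiffAt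

/-- Differentiating the commutation of `exp (A + sH)` with `A + sH` at a zero of the differential
shows that `exp A`, hence `A`, commutes with `H`. The differential is then `exp A * H`, and `exp A`
is a unit. -/
theorem Matrix.fderiv_exp_injOn_symm {A H : Matrix ι ι ℝ} (hA : Aᵀ = A)
    (h : fderiv ℝ (NormedSpace.exp : Matrix ι ι ℝ → Matrix ι ι ℝ) A H = 0) : H = 0 := by
  have hd : HasFDerivAt (NormedSpace.exp : Matrix ι ι ℝ → Matrix ι ι ℝ)
      (fderiv ℝ NormedSpace.exp A) (A + (0 : ℝ) • H) := by
    rw [zero_smul, add_zero]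
    exact (Matrix.contDiff_exp.differentiable (by simp) A).hasFDerivAt
  have hl : HasDerivAt (fun s : ℝ => A + s • H) H 0 := by
    have := ((hasDerivAt_id (0 : ℝ)).smul_const H).const_add A
    rw [one_smul] at this
    exact this
  have h1 : HasDerivAt (fun s : ℝ => NormedSpace.exp (A + s • H)) (0 : Matrix ι ι ℝ) 0 := by
    have := hd.comp_hasDerivAt (0 : ℝ) hl
    rw [h] at this
    exact this
  have hcomm : Commute A H := by
    apply Matrix.commute_of_commute_exp hA
    have h2 := h1.mul hl
    have h3 := hl.mul h1
    have h4 : ((fun s : ℝ => NormedSpace.exp (A + s • H)) * fun s : ℝ => A + s • H) =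
        (fun s : ℝ => A + s • H) * fun s : ℝ => NormedSpace.exp (A + s • H) := by
      funext s
      exact ((Commute.refl (A + s • H)).exp_left).eq
    rw [h4] at h2
    have h5 := h2.unique h3
    simp only [zero_smul, add_zero, zero_mul, mul_zero, zero_add] at h5
    exact h5
  have h6 : HasDerivAt (fun s : ℝ => NormedSpace.exp (A + s • H)) (NormedSpace.exp A * H) 0 := by
    have h7 : (fun s : ℝ => NormedSpace.exp (A + s • H)) =
        fun s : ℝ => NormedSpace.exp A * NormedSpace.exp (s • H) := by
      funext s
      exact Matrix.exp_add_of_commute _ _ (hcomm.smul_right s)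
    rw [h7]
    have h8 := (hasDerivAt_exp_smul_const (𝕂 := ℝ) H (0 : ℝ)).const_mul (NormedSpace.exp A)
    rw [zero_smul, NormedSpace.exp_zero, one_mul] at h8
    exact h8
  have h9 : NormedSpace.exp A * H = 0 := (h1.unique h6).symm
  exact (Matrix.isUnit_exp A).mul_right_eq_zero.1 h9

/-- The solutions of the geodesic equation `C'' = C' C⁻¹ C'`. -/
theorem eq_mul_exp_of_geodesic {C C' : ℝ → Matrix ι ι ℝ} (h1 : ∀ t, HasDerivAt C (C' t) t)
    (h2 : ∀ t, HasDerivAt C' (C' t * (C t)⁻¹ * C' t) t) (hd : ∀ t, (C t).det ≠ 0) (t : ℝ) :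
    C t = C 0 * NormedSpace.exp (t • ((C 0)⁻¹ * C' 0)) ∧ C' t = C t * ((C 0)⁻¹ * C' 0) := by
  have hu : ∀ t, IsUnit (C t).det := fun t => isUnit_iff_ne_zero.2 (hd t)
  -- The geodesic equation says that `C⁻¹ C'` is a first integral, which reduces it to the linear
  -- equation `C' = C A`.
  have hconst : ∀ t, (C t)⁻¹ * C' t = (C 0)⁻¹ * C' 0 := by
    have hder : ∀ s, HasDerivAt (fun s => (C s)⁻¹ * C' s) 0 s := by
      intro s
      have := ((h1 s).matrix_inv (hd s)).mul (h2 s)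
      have h0 : -((C s)⁻¹ * C' s * (C s)⁻¹) * C' s + (C s)⁻¹ * (C' s * (C s)⁻¹ * C' s) = 0 := by
        simp only [Matrix.mul_assoc, neg_mul, neg_add_cancel]
      rw [h0] at this
      exact this
    intro t
    exact is_const_of_deriv_eq_zero (fun s => (hder s).differentiableAt)
      (fun s => (hder s).deriv) t 0
  set A := (C 0)⁻¹ * C' 0 with hA
  have hC' : ∀ s, C' s = C s * A := by
    intro s
    rw [← hconst s, ← Matrix.mul_assoc, Matrix.mul_nonsing_inv _ (hu s), Matrix.one_mul]
  refine ⟨?_, hC' t⟩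
  have hder : ∀ s, HasDerivAt (fun s : ℝ => C s * NormedSpace.exp (s • (-A))) 0 s := by
    intro s
    have := (h1 s).mul (hasDerivAt_exp_smul_const' (𝕂 := ℝ) (-A) s)
    have h0 : C' s * NormedSpace.exp (s • -A) + C s * (-A * NormedSpace.exp (s • -A)) = 0 := by
      rw [hC' s]
      simp only [Matrix.mul_assoc, neg_mul, mul_neg, add_neg_cancel]
    rw [h0] at this
    exact this
  have hc := is_const_of_deriv_eq_zero (fun s => (hder s).differentiableAt)
      (fun s => (hder s).deriv) t 0
  simp only [zero_smul, NormedSpace.exp_zero, Matrix.mul_one] at hc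
  rw [← hc, Matrix.mul_assoc, ← Matrix.exp_add_of_commute, smul_neg, neg_add_cancel,
    NormedSpace.exp_zero, Matrix.mul_one]
  exact ((Commute.refl A).neg_left.smul_left t).smul_right t

end MatrixExp

/-! ### Charts of the Grassmannian along a moving frame -/

section GrassmannianCharts

variable {Q : Type*} [NormedAddCommGroup Q] [NormedSpace ℝ Q] [FiniteDimensional ℝ Q]

theorem grCoord_eq {P C : Submodule ℝ Q} (hPC : IsCompl P C) (f : P →L[ℝ] C) :
    grCoord P C (graphOf f) = f := by
  have h : ∃ g : P →L[ℝ] C, graphOf g = graphOf f := ⟨f, rfl⟩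
  rw [grCoord, dif_pos h]
  exact graphOf_injective hPC h.choose_spec

theorem isCompl_graphOf {P C : Submodule ℝ Q} (hPC : IsCompl P C) (f : P →L[ℝ] C) :
    IsCompl (graphOf f) C := by
  constructor
  · rw [Submodule.disjoint_def]
    rintro _ ⟨x, rfl⟩ hx
    have hx' : (x : Q) + (f x : Q) ∈ C := by simpa using hx
    have h1 : (x : Q) ∈ C := by simpa using C.sub_mem hx' (f x).2
    have h2 : (x : Q) = 0 := Submodule.disjoint_def.1 hPC.disjoint _ x.2 h1
    have h3 : x = 0 := Subtype.ext h2
    simp [h3]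
  · rw [codisjoint_iff, eq_top_iff]
    intro q _
    obtain ⟨p, hp, c, hc, rfl⟩ := Submodule.mem_sup.1
      ((codisjoint_iff.1 hPC.codisjoint).symm ▸ Submodule.mem_top : q ∈ P ⊔ C)
    refine Submodule.mem_sup.2 ⟨p + f ⟨p, hp⟩, ⟨⟨p, hp⟩, by simp⟩, c - f ⟨p, hp⟩,
      C.sub_mem hc (f _).2, by abel⟩

variable {E E' : Type*} [NormedAddCommGroup E] [NormedSpace ℝ E]
  [NormedAddCommGroup E'] [NormedSpace ℝ E'] [FiniteDimensional ℝ E']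

/-- The chart of the Grassmannian along the subspaces `range (F z)`. -/
theorem grCoord_range {F : E → E' →L[ℝ] Q} {z₀ : E} (hF : ContDiffAt ℝ ∞ F z₀)
    (hinj : Function.Injective (F z₀)) {P C : Submodule ℝ Q}
    (hP : P = LinearMap.range (F z₀ : E' →ₗ[ℝ] Q)) (hPC : IsCompl P C) :
    (∀ᶠ z in 𝓝 z₀, IsCompl (LinearMap.range (F z : E' →ₗ[ℝ] Q)) C) ∧
      ContDiffAt ℝ ∞ (fun z => grCoord P C (LinearMap.range (F z : E' →ₗ[ℝ] Q))) z₀ ∧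
      ∀ (v : E) (w : E') (y : P), (y : Q) = F z₀ w →
        P.mkQ (fderiv ℝ (fun z => grCoord P C (LinearMap.range (F z : E' →ₗ[ℝ] Q))) z₀ v y : Q) =
          P.mkQ (fderiv ℝ F z₀ v w) := by
  let πP : Q →L[ℝ] P := LinearMap.toContinuousLinearMap (P.projectionOnto C hPC)
  let πC : Q →L[ℝ] C := LinearMap.toContinuousLinearMap (C.projectionOnto P hPC.symm)
  have hsum : ∀ q : Q, (πP q : Q) + (πC q : Q) = q := fun q =>
    Submodule.projection_add_projection_eq_self hPC q
  have hπP : ∀ y : P, πP y = y := fun y => Submodule.projectionOnto_apply_left hPC y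
  have hπC : ∀ y : P, πC y = 0 := fun y => Submodule.projectionOnto_apply_right hPC.symm y
  have hmem : ∀ w, F z₀ w ∈ P := fun w => hP ▸ ⟨w, rfl⟩
  let G : E → E' →L[ℝ] P := fun z => πP ∘L F z
  have hG : ContDiffAt ℝ ∞ G z₀ := contDiffAt_const.clm_comp hF
  have hG0 : ∀ w, (G z₀ w : Q) = F z₀ w := fun w => by
    have := hsum (F z₀ w)
    have h0 : πC (F z₀ w) = 0 := hπC ⟨_, hmem w⟩
    rw [h0, ZeroMemClass.coe_zero, add_zero] at this
    exact this
  have hbij : Function.Bijective (G z₀ : E' →ₗ[ℝ] P) := by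
    constructor
    · intro a b hab
      apply hinj
      rw [← hG0, ← hG0]
      exact congrArg Subtype.val hab
    · intro y
      obtain ⟨w, hw⟩ : (y : Q) ∈ LinearMap.range (F z₀ : E' →ₗ[ℝ] Q) := hP ▸ y.2
      exact ⟨w, Subtype.ext ((hG0 w).trans hw)⟩
  let e : E' ≃L[ℝ] P := (LinearEquiv.ofBijective _ hbij).toContinuousLinearEquiv
  have he : (e : E' →L[ℝ] P) = G z₀ := by ext; rfl
  have hinv : ∀ᶠ z in 𝓝 z₀, (G z).IsInvertible := by
    have h1 := ContinuousLinearEquiv.nhds e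
    rw [he] at h1
    exact hG.continuousAt.eventually h1
  -- Near `z₀` the component `G z` along `P` is invertible, so the range of `F z` is the graph of
  -- the quotient of the two components.
  let K : E → P →L[ℝ] C := fun z => (πC ∘L F z) ∘L (G z).inverse
  have hK : ContDiffAt ℝ ∞ K z₀ := by
    have h1 : ContDiffAt ℝ ∞ (fun z => (G z).inverse) z₀ :=
      ContDiffAt.comp z₀ (ContinuousLinearMap.IsInvertible.contDiffAt_map_inverse ⟨e, he⟩) hG
    exact (contDiffAt_const.clm_comp hF).clm_comp h1
  have hKG : ∀ᶠ z in 𝓝 z₀, ∀ w, K z (G z w) = πC (F z w) := by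
    filter_upwards [hinv] with z hz w
    change πC (F z ((G z).inverse (G z w))) = _
    rw [hz.inverse_apply_self]
  have hgraph : ∀ᶠ z in 𝓝 z₀, graphOf (K z) = LinearMap.range (F z : E' →ₗ[ℝ] Q) := by
    filter_upwards [hinv, hKG] with z hz hk
    apply le_antisymm
    · rintro _ ⟨y, rfl⟩
      refine ⟨(G z).inverse y, ?_⟩
      have h1 := hk ((G z).inverse y)
      rw [hz.self_apply_inverse] at h1
      have h2 := hsum (F z ((G z).inverse y))
      rw [← h1] at h2
      have h3 : πP (F z ((G z).inverse y)) = y := hz.self_apply_inverse y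
      rw [h3] at h2
      simpa using h2.symm
    · rintro _ ⟨w, rfl⟩
      refine ⟨G z w, ?_⟩
      have h2 := hsum (F z w)
      rw [← hk w] at h2
      exact h2
  have hcoord : (fun z => grCoord P C (LinearMap.range (F z : E' →ₗ[ℝ] Q))) =ᶠ[𝓝 z₀] K := by
    filter_upwards [hgraph] with z hz
    rw [← hz, grCoord_eq hPC]
  refine ⟨?_, hK.congr_of_eventuallyEq hcoord, ?_⟩
  · filter_upwards [hgraph] with z hz
    rw [← hz]
    exact isCompl_graphOf hPC _
  · intro v w y hy
    rw [hcoord.fderiv_eq]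
    -- Since `K` vanishes at `z₀`, the product rule for `K z (G z w) = πC (F z w)` keeps only the
    -- derivative of `K`.
    have hK0 : K z₀ = 0 := by
      ext y : 1
      obtain ⟨w, rfl⟩ := hbij.2 y
      have h1 : K z₀ (G z₀ w) = πC (F z₀ w) := hKG.self_of_nhds w
      exact h1.trans (hπC ⟨_, hmem w⟩)
    have hKd := (hK.differentiableAt (by simp)).hasFDerivAt
    have hGd := (hG.differentiableAt (by simp)).hasFDerivAt
    have hFd := (hF.differentiableAt (by simp)).hasFDerivAt
    have h1 : HasFDerivAt (fun z => K z (G z w))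
        (fderiv ℝ K z₀ |>.flip (G z₀ w)) z₀ := by
      have := hKd.clm_apply (hGd.clm_apply (hasFDerivAt_const w z₀))
      rw [hK0] at this
      refine this.congr_fderiv ?_
      ext
      simp
    have h2 : HasFDerivAt (fun z => πC (F z w)) (πC ∘L (fderiv ℝ F z₀).flip w) z₀ := by
      have := πC.hasFDerivAt.comp z₀ (hFd.clm_apply (hasFDerivAt_const w z₀))
      refine this.congr_fderiv ?_
      ext
      simp
    have h3 := h1.unique (h2.congr_of_eventuallyEq
      (by filter_upwards [hKG] with z hz using hz w))
    have h4 := DFunLike.congr_fun h3 v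
    have h5 : fderiv ℝ K z₀ v (G z₀ w) = πC (fderiv ℝ F z₀ v w) := h4
    have h6 : y = G z₀ w := Subtype.ext (hy.trans (hG0 w).symm)
    rw [h6, h5, ← sub_eq_zero, ← map_sub, Submodule.mkQ_apply, Submodule.Quotient.mk_eq_zero]
    have h7 := hsum (fderiv ℝ F z₀ v w)
    have h8 : ((πC (fderiv ℝ F z₀ v w) : C) : Q) - fderiv ℝ F z₀ v w =
        -(πP (fderiv ℝ F z₀ v w) : Q) := by
      nth_rewrite 2 [← h7]
      abel
    rw [h8]
    exact P.neg_mem (πP _).2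

end GrassmannianCharts

/-! ### Continuous dependence of lifted endpoints -/

section PathLifting

open Set Filter

/-- This replaces smooth dependence of geodesics on initial data: the paths are merely chosen one by
one, but their images under the locally injective `B` are prescribed rays. Near one path, `B` is
injective on a compact neighbourhood, which nearby paths cannot leave and in which `B` determines
the endpoint. -/
theorem continuous_endpoint_of_lift {M Y F : Type*} [TopologicalSpace M] [LocallyCompactSpace M]
    [TopologicalSpace Y] [T2Space M] [T2Space Y] [NormedAddCommGroup F] [NormedSpace ℝ F]
    {B : M → Y} (hB : Continuous B) (hloc : ∀ x, ∃ u ∈ 𝓝 x, InjOn B u)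
    {φ : F → Y} (hφ : Continuous φ) (hinj : Function.Injective φ) {x : M} {γ : F → ℝ → M}
    (hγ : ∀ v, Continuous (γ v)) (h0 : ∀ v, γ v 0 = x) (hx : ∀ t, γ 0 t = x)
    (hBγ : ∀ v t, B (γ v t) = φ (t • v)) : Continuous fun v => γ v 1 := by
  rw [continuous_iff_continuousAt]
  intro v₀
  set S : Set M := γ v₀ '' Icc 0 1 with hS
  have hSc : IsCompact S := isCompact_Icc.image (hγ v₀)
  have hSinj : InjOn B S := by
    rintro _ ⟨s, hs, rfl⟩ _ ⟨t, ht, rfl⟩ hst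
    by_cases hv : v₀ = 0
    · rw [hv, hx, hx]
    · rw [hBγ, hBγ] at hst
      rw [smul_left_injective ℝ hv (hinj hst)]
  -- Local injectivity, together with injectivity on a compact set, gives injectivity on a
  -- neighbourhood of that set.
  obtain ⟨U', hU', hU'inj⟩ := hSinj.exists_mem_nhdsSet hSc (fun y _ => hB.continuousAt)
    (fun y _ => hloc y)
  obtain ⟨U, hUo, hSU, hUU'⟩ := mem_nhdsSet_iff_exists.1 hU'
  obtain ⟨K, hK, hSK, hKU⟩ := exists_compact_between hSc hUo hSU
  have hKinj : InjOn B K := hU'inj.mono (hKU.trans hUU')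
  have hKcl : IsClosed K := hK.isClosed
  have hfr : IsCompact (frontier K) := hK.of_isClosed_subset isClosed_frontier hKcl.frontier_subset
  have hfrB : IsClosed (B '' frontier K) := (hfr.image hB).isClosed
  -- By compactness of the time interval, nearby rays avoid the image of the frontier of `K`, so
  -- their lifts, which start in the interior, stay in `K`.
  have hev : ∀ᶠ v in 𝓝 v₀, ∀ t ∈ Icc (0 : ℝ) 1, φ (t • v) ∉ B '' frontier K := by
    refine isCompact_Icc.eventually_forall_of_forall_eventually fun t ht => ?_
    have hc : ContinuousAt (fun p : F × ℝ => φ (p.2 • p.1)) (v₀, t) := by fun_prop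
    refine hc.eventually (hfrB.isOpen_compl.mem_nhds ?_)
    rintro ⟨y, hy, hyφ⟩
    simp only at hyφ
    rw [← hBγ] at hyφ
    have hyS : y = γ v₀ t := hKinj (hKcl.frontier_subset hy)
      (interior_subset (hSK ⟨t, ht, rfl⟩)) hyφ
    exact hy.2 (hyS ▸ hSK ⟨t, ht, rfl⟩)
  have hmem : ∀ᶠ v in 𝓝 v₀, γ v 1 ∈ K := by
    filter_upwards [hev] with v hv
    by_contra hne
    have hpre : IsPreconnected (γ v '' Icc 0 1) := isPreconnected_Icc.image _ (hγ v).continuousOn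
    have hx0 : x ∈ interior K := by
      rw [← h0 v₀]
      exact hSK ⟨0, by simp, rfl⟩
    obtain ⟨y, -, hy1, hy2⟩ := hpre (interior K) Kᶜ isOpen_interior hKcl.isOpen_compl
      (by
        rintro _ ⟨t, ht, rfl⟩
        by_cases hK' : γ v t ∈ K
        · left
          by_contra hne'
          exact hv t ht ⟨_, ⟨subset_closure hK', hne'⟩, hBγ v t⟩
        · exact Or.inr hK')
      ⟨x, ⟨0, by simp, h0 v⟩, hx0⟩ ⟨γ v 1, ⟨1, by simp, rfl⟩, hne⟩
    exact hy2 (interior_subset hy1)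
  have hBE : ∀ v, B (γ v 1) = φ v := fun v => by rw [hBγ, one_smul]
  refine hK.tendsto_nhds_of_unique_mapClusterPt hmem fun y hy hcl => ?_
  have h1 : MapClusterPt (B y) (𝓝 v₀) (B ∘ fun v => γ v 1) := hcl.continuousAt_comp hB.continuousAt
  have h2 : Tendsto (B ∘ fun v => γ v 1) (𝓝 v₀) (𝓝 (φ v₀)) := by
    have : (B ∘ fun v => γ v 1) = φ := funext hBE
    rw [this]
    exact hφ.continuousAt
  have h3 : B y = φ v₀ := by
    have : ClusterPt (B y) (𝓝 (φ v₀)) := ClusterPt.mono h1 h2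
    exact eq_of_nhds_neBot this
  rw [← hBE] at h3
  exact hKinj hy (interior_subset (hSK ⟨1, by simp, rfl⟩)) h3

end PathLifting

/-! ### Orthogonality for the invariant metric and unimodular curves -/

section MetricAlgebra

variable {V : Type*} [NormedAddCommGroup V] [NormedSpace ℝ V] [FiniteDimensional ℝ V]
  {ι : Type*} [Fintype ι] [DecidableEq ι]

/-- The bilinear form `(q, r) ↦ Tr(G⁻¹ q G⁻¹ r)` in a basis where `G` is the Gram matrix of `B`. -/
def metricForm (e : Module.Basis ι ℝ V) (B : Quad V) : LinearMap.BilinForm ℝ (Quad V) :=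
  LinearMap.mk₂ ℝ
    (fun q r => ((gram e B)⁻¹ * gram e q * ((gram e B)⁻¹ * gram e r)).trace)
    (fun p q r => by simp [Matrix.mul_add, Matrix.add_mul])
    (fun c q r => by simp)
    (fun p q r => by simp [Matrix.mul_add])
    (fun c q r => by simp)

theorem metricForm_apply (e : Module.Basis ι ℝ V) (B q r : Quad V) :
    metricForm e B q r = ((gram e B)⁻¹ * gram e q * ((gram e B)⁻¹ * gram e r)).trace := rfl

theorem metricForm_comm (e : Module.Basis ι ℝ V) (B q r : Quad V) :
    metricForm e B q r = metricForm e B r q :=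
  Matrix.trace_mul_comm _ _

theorem metricForm_self_pos (e : Module.Basis ι ℝ V) {B : Quad V} (hB : B.IsPos) {q : Quad V}
    (hq : metricForm e B q q ≤ 0) : q = 0 := by
  obtain ⟨R, hR, hu⟩ := exists_conjTranspose_mul_self ((gram_posDef_iff e B).2 hB)
  have hdet : IsUnit R.det := (Matrix.isUnit_iff_isUnit_det R).1 hu
  set S : Matrix ι ι ℝ := (R⁻¹)ᵀ * gram e q * R⁻¹ with hS
  have hSs : Sᵀ = S := by
    rw [hS, Matrix.transpose_mul, Matrix.transpose_mul, gram_transpose, Matrix.transpose_transpose,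
      Matrix.mul_assoc]
  have hinv : (gram e B)⁻¹ = R⁻¹ * (R⁻¹)ᵀ := by
    rw [hR, Matrix.mul_inv_rev, Matrix.conjTranspose_eq_transpose_of_trivial,
      Matrix.transpose_nonsing_inv]
  have h1 : metricForm e B q q = (S * S).trace := by
    rw [metricForm_apply, hinv, hS]
    have := Matrix.trace_mul_comm R⁻¹
      ((R⁻¹)ᵀ * gram e q * (R⁻¹ * (R⁻¹)ᵀ * gram e q))
    simp only [Matrix.mul_assoc] at this ⊢
    exact this
  have h2 : S = 0 := Matrix.eq_zero_of_transpose_eq_of_trace_sq_le hSs (h1 ▸ hq)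
  apply gram_injective e
  rw [map_zero]
  have hu1 : IsUnit R⁻¹ := (Matrix.isUnit_nonsing_inv_iff).2 hu
  have hu2 : IsUnit (R⁻¹)ᵀ := (Matrix.isUnit_transpose _).2 hu1
  rw [hS, hu1.mul_left_eq_zero, hu2.mul_right_eq_zero] at h2
  exact h2

theorem metricForm_nondegenerate (e : Module.Basis ι ℝ V) {B : Quad V} (hB : B.IsPos) :
    (metricForm e B).Nondegenerate := by
  constructor
  · intro q hq
    exact metricForm_self_pos e hB (hq q).le
  · intro q hq
    exact metricForm_self_pos e hB (hq q).le

/-- If `P` and `η` are tangent to the quadrics of determinant one, and `η` is orthogonal to the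
tangent vectors that are orthogonal to `P`, then `η ∈ P`. -/
theorem mem_of_forall_metricForm_eq_zero (e : Module.Basis ι ℝ V) {B : Quad V} (hB : B.IsPos)
    {P : Submodule ℝ (Quad V)} (hP : ∀ p ∈ P, ((gram e B)⁻¹ * gram e p).trace = 0) {η : Quad V}
    (hη : ((gram e B)⁻¹ * gram e η).trace = 0)
    (h : ∀ ξ : Quad V, ((gram e B)⁻¹ * gram e ξ).trace = 0 →
      (∀ p ∈ P, metricForm e B p ξ = 0) → metricForm e B η ξ = 0) : η ∈ P := by
  have hu : IsUnit (gram e B).det :=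
    (Matrix.isUnit_iff_isUnit_det _).1 ((gram_posDef_iff e B).2 hB).isUnit
  have hgB : ∀ q, metricForm e B q B = ((gram e B)⁻¹ * gram e q).trace := by
    intro q
    rw [metricForm_apply, Matrix.nonsing_inv_mul _ hu, Matrix.mul_one]
  have hrefl : (metricForm e B).IsRefl := fun q r hqr => by rw [metricForm_comm, hqr]
  -- Membership in `P` is tested on its double orthogonal. The vectors `ξ` arising there need not be
  -- unimodular tangents, and are corrected below.
  rw [← LinearMap.BilinForm.orthogonal_orthogonal (metricForm_nondegenerate e hB) hrefl P]
  rw [LinearMap.BilinForm.mem_orthogonal_iff]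
  intro ξ hξ
  rw [LinearMap.BilinForm.mem_orthogonal_iff] at hξ
  change metricForm e B ξ η = 0
  rw [metricForm_comm]
  -- The direction `B` is normal to the unimodular hypersurface and has square norm `card ι`; `c •
  -- B` is the normal part of `ξ`, orthogonal to both `P` and `η`.
  set c : ℝ := ((gram e B)⁻¹ * gram e ξ).trace / Fintype.card ι with hc
  have h1 : ((gram e B)⁻¹ * gram e (ξ - c • B)).trace = 0 := by
    rw [map_sub, map_smul, Matrix.mul_sub, Matrix.mul_smul, Matrix.nonsing_inv_mul _ hu,
      Matrix.trace_sub, Matrix.trace_smul, Matrix.trace_one, smul_eq_mul]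
    rcases isEmpty_or_nonempty ι with hi | hi
    · simp [Matrix.trace]
    · rw [hc, div_mul_cancel₀ _ (by positivity), sub_self]
  have h2 := h (ξ - c • B) h1 (fun p hp => by
    have h3 : metricForm e B p ξ = 0 := hξ p hp
    rw [map_sub, map_smul, hgB, hP p hp, h3]
    simp)
  rw [map_sub, map_smul, hgB, hη] at h2
  simpa using h2

theorem isUnimodularTangent_iff {e : Module.Basis ι ℝ V} {B : Quad V} (hB : B.IsPos) (ξ : Quad V) :
    IsUnimodularTangent B ξ ↔ ((gram e B)⁻¹ * gram e ξ).trace = 0 := by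
  rw [IsUnimodularTangent, trace_inverse_comp ((gram_posDef_iff e B).2 hB).det_pos.ne']

/-- The quadric `q B⁻¹ q`. -/
theorem exists_gram_eq_sandwich (e : Module.Basis ι ℝ V) {B : Quad V} (hB : B.IsPos) (q : Quad V) :
    ∃ r : Quad V, gram e r = gram e q * (gram e B)⁻¹ * gram e q ∧ (q.IsNondeg → r.IsPos) := by
  have hs : (gram e q * (gram e B)⁻¹ * gram e q)ᵀ = gram e q * (gram e B)⁻¹ * gram e q := by
    rw [Matrix.transpose_mul, Matrix.transpose_mul, gram_transpose, Matrix.transpose_nonsing_inv,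
      gram_transpose, Matrix.mul_assoc]
  obtain ⟨r, hr⟩ := exists_gram_eq e hs
  refine ⟨r, hr, fun hq => (gram_posDef_iff e r).1 ?_⟩
  have hinv : (gram e B)⁻¹.PosDef := ((gram_posDef_iff e B).2 hB).inv
  have hu : IsUnit (gram e q) :=
    (Matrix.isUnit_iff_isUnit_det _).2 (isUnit_iff_ne_zero.2 (gram_det_ne_zero hq))
  have := (Matrix.IsUnit.posDef_star_left_conjugate_iff hu (x := (gram e B)⁻¹)).2 hinv
  rw [hr]
  have h2 : star (gram e q) = gram e q := gram_transpose e q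
  rwa [h2] at this

theorem ContDiffAt.deriv_top {F : Type*} [NormedAddCommGroup F] [NormedSpace ℝ F] {c : ℝ → F}
    {t : ℝ} (hc : ContDiffAt ℝ ∞ c t) : ContDiffAt ℝ ∞ (deriv c) t := by
  have h : deriv c = fun s => fderiv ℝ c s 1 := funext fun s => fderiv_apply_one_eq_deriv.symm
  rw [h]
  exact (hc.fderiv_right (by simp)).clm_apply contDiffAt_const

/-- The second identity is the derivative of the first along the curve: the acceleration taken in
the cone is already tangent to the hypersurface of fixed determinant. -/
theorem trace_inv_mul_deriv_curve (e : Module.Basis ι ℝ V) {c : ℝ → Quad V} {t : ℝ}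
    (hc : ContDiffAt ℝ ∞ c t) {δ : ℝ} (hδ : δ ≠ 0) (hdet : ∀ᶠ s in 𝓝 t, (gram e (c s)).det = δ) :
    ((gram e (c t))⁻¹ * gram e (deriv c t)).trace = 0 ∧
      ((gram e (c t))⁻¹ * (gram e (deriv (deriv c) t) -
        gram e (deriv c t) * (gram e (c t))⁻¹ * gram e (deriv c t))).trace = 0 := by
  have hd : ∀ᶠ s in 𝓝 t, HasDerivAt (fun s => gram e (c s)) (gram e (deriv c s)) s := by
    filter_upwards [(hc.of_le (m := 1) (by simp)).eventually (by simp)] with s hs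
    exact (gram e).hasFDerivAt.comp_hasDerivAt s (hs.differentiableAt (by simp)).hasDerivAt
  have hd2 : HasDerivAt (fun s => gram e (deriv c s)) (gram e (deriv (deriv c) t)) t := by
    have h1 : ContDiffAt ℝ ∞ (deriv c) t := hc.deriv_top
    exact (gram e).hasFDerivAt.comp_hasDerivAt t (h1.differentiableAt (by simp)).hasDerivAt
  have htr : ∀ᶠ s in 𝓝 t, ((gram e (c s))⁻¹ * gram e (deriv c s)).trace = 0 := by
    filter_upwards [hd, hdet.eventually_nhds] with s hs hs'
    have h0 : (gram e (c s)).det ≠ 0 := by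
      rw [hs'.self_of_nhds]
      exact hδ
    exact trace_inv_mul_deriv_eq_zero (C := fun s => gram e (c s)) hs h0 hs'
  refine ⟨htr.self_of_nhds, ?_⟩
  have h0 : (gram e (c t)).det ≠ 0 := by
    rw [hdet.self_of_nhds]
    exact hδ
  have hi : HasDerivAt (fun s => (gram e (c s))⁻¹)
      (-((gram e (c t))⁻¹ * gram e (deriv c t) * (gram e (c t))⁻¹)) t :=
    HasDerivAt.matrix_inv (C := fun s => gram e (c s)) hd.self_of_nhds h0
  have h1 := Matrix.traceL.hasFDerivAt.comp_hasDerivAt t (hi.mul hd2)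
  have h2 := h1.unique ((hasDerivAt_const t (0 : ℝ)).congr_of_eventuallyEq htr)
  rw [Matrix.traceL_apply] at h2
  rw [← h2]
  congr 1
  simp only [Matrix.mul_sub, Matrix.mul_assoc, neg_mul]
  abel

end MetricAlgebra

/-! ### The Gauss map in charts -/

section Immersions

variable {V : Type*} [NormedAddCommGroup V] [NormedSpace ℝ V] [FiniteDimensional ℝ V]
  {n : ℕ} {b : Module.Basis (Fin (2 * n)) ℝ V}
  {d : ℕ} {M : Type*} [TopologicalSpace M]
  [ChartedSpace (EuclideanSpace ℝ (Fin d)) M] [IsManifold (𝓡 d) ∞ M]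
  {h : M → PosProj V}

theorem dualLift_spec (b : Module.Basis (Fin (2 * n)) ℝ V) (h : M → PosProj V) (x : M) :
    IsUnimodularDual b (h x) (dualLift b h x) :=
  (existsUnique_isUnimodularDual b (h x)).choose_spec.1

theorem dualLift_isPos (b : Module.Basis (Fin (2 * n)) ℝ V) (h : M → PosProj V) (x : M) :
    (dualLift b h x).IsPos := (dualLift_spec b h x).1

theorem det_gram_dualLift (b : Module.Basis (Fin (2 * n)) ℝ V) (h : M → PosProj V) (x : M) :
    (gram b (dualLift b h x)).det = 1 := (dualLift_spec b h x).2.1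

theorem det_gram_dualLift_ne_zero (b : Module.Basis (Fin (2 * n)) ℝ V) (h : M → PosProj V)
    (x : M) : (gram b (dualLift b h x)).det ≠ 0 := by
  rw [det_gram_dualLift]
  exact one_ne_zero

/-- The dual lift of `h` in the preferred chart around `x`. -/
def localLift (b : Module.Basis (Fin (2 * n)) ℝ V) (h : M → PosProj V) (x : M)
    (z : EuclideanSpace ℝ (Fin d)) : Quad V :=
  dualLift b h ((extChartAt (𝓡 d) x).symm z)

theorem contDiffAt_localLift (hh : IsSymImmersion d b h) (x : M) {z : EuclideanSpace ℝ (Fin d)}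
    (hz : z ∈ (extChartAt (𝓡 d) x).target) : ContDiffAt ℝ ∞ (localLift b h x) z := by
  have h1 : ContMDiffOn 𝓘(ℝ, EuclideanSpace ℝ (Fin d)) 𝓘(ℝ, Quad V) ∞ (localLift b h x)
      (extChartAt (𝓡 d) x).target :=
    hh.smooth.comp_contMDiffOn (contMDiffOn_extChartAt_symm x)
  exact (contMDiffOn_iff_contDiffOn.1 h1).contDiffAt ((isOpen_extChartAt_target x).mem_nhds hz)

theorem mdifferentiableAt_dualLift (hh : IsSymImmersion d b h) (x : M) :
    MDifferentiableAt (𝓡 d) 𝓘(ℝ, Quad V) (dualLift b h) x :=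
  (hh.smooth x).mdifferentiableAt (by simp)

theorem dualDeriv_eq_fderiv (hh : IsSymImmersion d b h) (x : M) :
    dualDeriv d b h x = fderiv ℝ (localLift b h x) (extChartAt (𝓡 d) x x) := by
  rw [dualDeriv, (mdifferentiableAt_dualLift hh x).mfderiv]
  have : Set.range (𝓡 d) = Set.univ := ModelWithCorners.Boundaryless.range_eq_univ
  rw [this, fderivWithin_univ]
  rfl

theorem mdifferentiableAt_extChartAt_symm (x : M) {z : EuclideanSpace ℝ (Fin d)}
    (hz : z ∈ (extChartAt (𝓡 d) x).target) :
    MDifferentiableAt 𝓘(ℝ, EuclideanSpace ℝ (Fin d)) (𝓡 d) (extChartAt (𝓡 d) x).symm z :=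
  ((contMDiffOn_extChartAt_symm (n := ∞) x).contMDiffAt
    ((isOpen_extChartAt_target x).mem_nhds hz)).mdifferentiableAt (by simp)

theorem fderiv_localLift (hh : IsSymImmersion d b h) (x : M) {z : EuclideanSpace ℝ (Fin d)}
    (hz : z ∈ (extChartAt (𝓡 d) x).target) :
    fderiv ℝ (localLift b h x) z = (dualDeriv d b h ((extChartAt (𝓡 d) x).symm z)).comp
      (mfderiv 𝓘(ℝ, EuclideanSpace ℝ (Fin d)) (𝓡 d) (extChartAt (𝓡 d) x).symm z) := by
  rw [← mfderiv_eq_fderiv]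
  exact mfderiv_comp z (mdifferentiableAt_dualLift hh _) (mdifferentiableAt_extChartAt_symm x hz)

theorem isInvertible_mfderiv_symm (x : M) {z : EuclideanSpace ℝ (Fin d)}
    (hz : z ∈ (extChartAt (𝓡 d) x).target) :
    (mfderiv 𝓘(ℝ, EuclideanSpace ℝ (Fin d)) (𝓡 d) (extChartAt (𝓡 d) x).symm z).IsInvertible := by
  have := isInvertible_mfderivWithin_extChartAt_symm (I := 𝓡 d) hz
  have hr : Set.range (𝓡 d) = Set.univ := ModelWithCorners.Boundaryless.range_eq_univ
  rwa [hr, mfderivWithin_univ] at this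

/-- Derivatives of charts are invertible, so the derivative of the local lift is a smooth moving
frame of the Gauss pencils, as `grCoord_range` requires. -/
theorem range_fderiv_localLift (hh : IsSymImmersion d b h) (x : M)
    {z : EuclideanSpace ℝ (Fin d)} (hz : z ∈ (extChartAt (𝓡 d) x).target) :
    LinearMap.range (fderiv ℝ (localLift b h x) z : EuclideanSpace ℝ (Fin d) →ₗ[ℝ] Quad V) =
      (gaussMap hh ((extChartAt (𝓡 d) x).symm z)).1 := by
  rw [fderiv_localLift hh x hz]
  apply le_antisymm
  · rintro _ ⟨w, rfl⟩
    exact ⟨_, rfl⟩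
  · rintro _ ⟨w, rfl⟩
    obtain ⟨w', hw'⟩ := (isInvertible_mfderiv_symm x hz).surjective w
    refine ⟨w', ?_⟩
    change dualDeriv d b h _ _ = _
    rw [← hw']
    rfl

theorem injective_fderiv_localLift (hh : IsSymImmersion d b h) (x : M)
    {z : EuclideanSpace ℝ (Fin d)} (hz : z ∈ (extChartAt (𝓡 d) x).target) :
    Function.Injective (fderiv ℝ (localLift b h x) z) := by
  rw [fderiv_localLift hh x hz]
  exact (hh.injective _).comp (isInvertible_mfderiv_symm x hz).injective

theorem gaussMap_eventuallyEq (hh : IsSymImmersion d b h) (x : M) :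
    ∀ᶠ y in 𝓝 x, (gaussMap hh y).1 = LinearMap.range
      (fderiv ℝ (localLift b h x) (extChartAt (𝓡 d) x y) :
        EuclideanSpace ℝ (Fin d) →ₗ[ℝ] Quad V) := by
  filter_upwards [extChartAt_source_mem_nhds (I := 𝓡 d) x] with y hy
  rw [range_fderiv_localLift hh x ((extChartAt (𝓡 d) x).map_source hy),
    (extChartAt (𝓡 d) x).left_inv hy]

theorem contDiffAt_fderiv_localLift (hh : IsSymImmersion d b h) (x : M) :
    ContDiffAt ℝ ∞ (fderiv ℝ (localLift b h x)) (extChartAt (𝓡 d) x x) :=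
  (contDiffAt_localLift hh x (mem_extChartAt_target x)).fderiv_right (by simp)

theorem gaussMap_eq_range (hh : IsSymImmersion d b h) (x : M) :
    (gaussMap hh x).1 = LinearMap.range
      (fderiv ℝ (localLift b h x) (extChartAt (𝓡 d) x x) :
        EuclideanSpace ℝ (Fin d) →ₗ[ℝ] Quad V) :=
  (gaussMap_eventuallyEq hh x).self_of_nhds

theorem grSmoothAt_gaussMap (hh : IsSymImmersion d b h) (x : M) :
    GrSmoothAt (gaussMap hh) x := by
  intro C hC
  obtain ⟨h1, h2, -⟩ := grCoord_range (contDiffAt_fderiv_localLift hh x)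
    (injective_fderiv_localLift hh x (mem_extChartAt_target x)) (gaussMap_eq_range hh x) hC
  have hcont : Filter.Tendsto (extChartAt (𝓡 d) x) (𝓝 x) (𝓝 (extChartAt (𝓡 d) x x)) :=
    continuousAt_extChartAt x
  constructor
  · filter_upwards [gaussMap_eventuallyEq hh x, hcont.eventually h1] with y hy hy'
    rw [hy]
    exact hy'
  · have h3 := h2.contMDiffAt.comp x (contMDiffAt_extChartAt (I := 𝓡 d) (n := ∞) (x := x))
    refine h3.congr_of_eventuallyEq ?_
    filter_upwards [gaussMap_eventuallyEq hh x] with y hy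
    rw [hy]
    rfl

theorem grDeriv_gaussMap (hh : IsSymImmersion d b h) (x : M) {C : Submodule ℝ (Quad V)}
    (hC : IsCompl (gaussMap hh x).1 C) (v w : EuclideanSpace ℝ (Fin d)) (y : (gaussMap hh x).1)
    (hy : (y : Quad V) = fderiv ℝ (localLift b h x) (extChartAt (𝓡 d) x x) w) :
    grDeriv (gaussMap hh) x C v y = (gaussMap hh x).1.mkQ
      (fderiv ℝ (fderiv ℝ (localLift b h x)) (extChartAt (𝓡 d) x x) v w) := by
  obtain ⟨-, -, h3⟩ := grCoord_range (contDiffAt_fderiv_localLift hh x)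
    (injective_fderiv_localLift hh x (mem_extChartAt_target x)) (gaussMap_eq_range hh x) hC
  rw [← h3 v w y hy]
  have hmd : MDifferentiableAt (𝓡 d) 𝓘(ℝ, (gaussMap hh x).1 →L[ℝ] C)
      (fun y => grCoord (gaussMap hh x).1 C (gaussMap hh y).1) x :=
    ((grSmoothAt_gaussMap hh x C hC).2).mdifferentiableAt (by simp)
  have hr : Set.range (𝓡 d) = Set.univ := ModelWithCorners.Boundaryless.range_eq_univ
  have heq : writtenInExtChartAt (𝓡 d) 𝓘(ℝ, (gaussMap hh x).1 →L[ℝ] C) x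
      (fun y => grCoord (gaussMap hh x).1 C (gaussMap hh y).1) =ᶠ[𝓝 (extChartAt (𝓡 d) x x)]
      (fun z => grCoord (gaussMap hh x).1 C
        (LinearMap.range (fderiv ℝ (localLift b h x) z : EuclideanSpace ℝ (Fin d) →ₗ[ℝ] Quad V))) := by
    filter_upwards [extChartAt_target_mem_nhds (I := 𝓡 d) x] with z hz
    rw [range_fderiv_localLift hh x hz]
    rfl
  have hD : mfderiv (𝓡 d) 𝓘(ℝ, (gaussMap hh x).1 →L[ℝ] C)
      (fun y => grCoord (gaussMap hh x).1 C (gaussMap hh y).1) x =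
      fderiv ℝ (fun z => grCoord (gaussMap hh x).1 C
        (LinearMap.range (fderiv ℝ (localLift b h x) z :
          EuclideanSpace ℝ (Fin d) →ₗ[ℝ] Quad V))) (extChartAt (𝓡 d) x x) := by
    rw [hmd.mfderiv, hr, fderivWithin_univ, heq.fderiv_eq]
  rw [← hD]
  rfl

end Immersions

/-! ### Total geodesy and the fitting property -/

section TotallyGeodesic

variable {V : Type*} [NormedAddCommGroup V] [NormedSpace ℝ V] [FiniteDimensional ℝ V]
  {n : ℕ} {b : Module.Basis (Fin (2 * n)) ℝ V}
  {d : ℕ} {M : Type*} [TopologicalSpace M]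
  [ChartedSpace (EuclideanSpace ℝ (Fin d)) M] [IsManifold (𝓡 d) ∞ M]
  {h : M → PosProj V}

theorem contDiffAt_dualLift_comp (hh : IsSymImmersion d b h) {γ : ℝ → M} {t : ℝ}
    (hγ : ContMDiffAt 𝓘(ℝ, ℝ) (𝓡 d) ∞ γ t) :
    ContDiffAt ℝ ∞ (fun s => dualLift b h (γ s)) t :=
  ((hh.smooth (γ t)).comp t hγ).contDiffAt

theorem hasDerivAt_dualLift_comp (hh : IsSymImmersion d b h) {γ : ℝ → M} {t : ℝ}
    (hγ : MDifferentiableAt 𝓘(ℝ, ℝ) (𝓡 d) γ t) :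
    HasDerivAt (fun s => dualLift b h (γ s))
      (dualDeriv d b h (γ t) (mfderiv 𝓘(ℝ, ℝ) (𝓡 d) γ t (1 : ℝ))) t := by
  have h1 := (mdifferentiableAt_dualLift hh (γ t)).hasMFDerivAt.comp t hγ.hasMFDerivAt
  have h2 : HasMFDerivAt 𝓘(ℝ, ℝ) 𝓘(ℝ, Quad V) (fun s => dualLift b h (γ s)) t
      ((dualDeriv d b h (γ t)).comp (mfderiv 𝓘(ℝ, ℝ) (𝓡 d) γ t)) := h1
  have h3 : HasFDerivAt (fun s => dualLift b h (γ s))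
      ((dualDeriv d b h (γ t)).comp (mfderiv 𝓘(ℝ, ℝ) (𝓡 d) γ t) : ℝ →L[ℝ] Quad V) t :=
    h2.hasFDerivAt
  exact HasFDerivAt.hasDerivAt h3

theorem localLift_line (x : M) (z v : EuclideanSpace ℝ (Fin d)) :
    (fun s : ℝ => dualLift b h ((extChartAt (𝓡 d) x).symm (z + s • v))) =
      fun s : ℝ => localLift b h x (z + s • v) := rfl

theorem contMDiffAt_chart_line (x : M) (v : EuclideanSpace ℝ (Fin d)) :
    ContMDiffAt 𝓘(ℝ, ℝ) (𝓡 d) ∞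
      (fun s : ℝ => (extChartAt (𝓡 d) x).symm (extChartAt (𝓡 d) x x + s • v)) 0 := by
  have h1 : ContMDiffAt 𝓘(ℝ, EuclideanSpace ℝ (Fin d)) (𝓡 d) ∞ (extChartAt (𝓡 d) x).symm
      (extChartAt (𝓡 d) x x + (0 : ℝ) • v) := by
    rw [zero_smul, add_zero]
    exact (contMDiffOn_extChartAt_symm x).contMDiffAt (extChartAt_target_mem_nhds x)
  have h2 : ContDiffAt ℝ ∞ (fun s : ℝ => extChartAt (𝓡 d) x x + s • v) 0 := by fun_prop
  exact h1.comp (0 : ℝ) h2.contMDiffAt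

theorem deriv_localLift_line (hh : IsSymImmersion d b h) (x : M) (v : EuclideanSpace ℝ (Fin d)) :
    deriv (fun s : ℝ => localLift b h x (extChartAt (𝓡 d) x x + s • v)) 0 =
        fderiv ℝ (localLift b h x) (extChartAt (𝓡 d) x x) v ∧
      deriv (deriv (fun s : ℝ => localLift b h x (extChartAt (𝓡 d) x x + s • v))) 0 =
        fderiv ℝ (fderiv ℝ (localLift b h x)) (extChartAt (𝓡 d) x x) v v := by
  set z := extChartAt (𝓡 d) x x
  have hline : ∀ s : ℝ, HasDerivAt (fun s : ℝ => z + s • v) v s := fun s => by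
    simpa using ((hasDerivAt_id s).smul_const v).const_add z
  have h0 : z + (0 : ℝ) • v = z := by simp
  have hev : ∀ᶠ s in 𝓝 (0 : ℝ), z + s • v ∈ (extChartAt (𝓡 d) x).target := by
    apply (hline 0).continuousAt.eventually_mem
    rw [h0]
    exact extChartAt_target_mem_nhds x
  have h1 : ∀ᶠ s in 𝓝 (0 : ℝ), deriv (fun s : ℝ => localLift b h x (z + s • v)) s =
      fderiv ℝ (localLift b h x) (z + s • v) v := by
    filter_upwards [hev] with s hs
    have h2 := ((contDiffAt_localLift hh x hs).differentiableAt (by simp)).hasFDerivAt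
    exact (h2.comp_hasDerivAt s (hline s)).deriv
  constructor
  · rw [h1.self_of_nhds, h0]
  · have h3 : deriv (fun s : ℝ => localLift b h x (z + s • v)) =ᶠ[𝓝 0]
        fun s => fderiv ℝ (localLift b h x) (z + s • v) v := h1
    rw [h3.deriv_eq]
    have h4 : HasFDerivAt (fderiv ℝ (localLift b h x))
        (fderiv ℝ (fderiv ℝ (localLift b h x)) z) (z + (0 : ℝ) • v) := by
      rw [h0]
      exact ((contDiffAt_fderiv_localLift hh x).differentiableAt (by simp)).hasFDerivAt
    have h5 : HasDerivAt (fun s : ℝ => fderiv ℝ (localLift b h x) (z + s • v))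
        (fderiv ℝ (fderiv ℝ (localLift b h x)) z v) 0 := h4.comp_hasDerivAt (0 : ℝ) (hline 0)
    have h6 := (ContinuousLinearMap.apply ℝ (Quad V) v).hasFDerivAt.comp_hasDerivAt (0 : ℝ) h5
    exact h6.deriv

theorem trace_dualDeriv_eq_zero (hh : IsSymImmersion d b h) (x : M)
    (v : EuclideanSpace ℝ (Fin d)) :
    ((gram b (dualLift b h x))⁻¹ * gram b (dualDeriv d b h x v)).trace = 0 := by
  have h1 := contDiffAt_dualLift_comp hh (contMDiffAt_chart_line x v)
  have h2 := (trace_inv_mul_deriv_curve b h1 one_ne_zero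
    (Filter.Eventually.of_forall fun s => det_gram_dualLift b h _)).1
  rw [localLift_line, (deriv_localLift_line hh x v).1, zero_smul, add_zero,
    extChartAt_to_inv] at h2
  rw [dualDeriv_eq_fderiv hh]
  exact h2

theorem trace_eq_zero_of_mem_gaussMap (hh : IsSymImmersion d b h) {x : M} {p : Quad V}
    (hp : p ∈ (gaussMap hh x).1) : ((gram b (dualLift b h x))⁻¹ * gram b p).trace = 0 := by
  obtain ⟨v, rfl⟩ := hp
  exact trace_dualDeriv_eq_zero hh x v

/-- The acceleration of a curve in a totally geodesic immersed submanifold. -/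
theorem IsTotallyGeodesic.exists_accel (hgeod : IsTotallyGeodesic d b h)
    (hh : IsSymImmersion d b h) {γ : ℝ → M} {t : ℝ}
    (hγ : ContMDiffAt 𝓘(ℝ, ℝ) (𝓡 d) ∞ γ t) :
    ∃ r ∈ (gaussMap hh (γ t)).1,
      gram b r = gram b (deriv (deriv fun s => dualLift b h (γ s)) t) -
        gram b (deriv (fun s => dualLift b h (γ s)) t) * (gram b (dualLift b h (γ t)))⁻¹ *
          gram b (deriv (fun s => dualLift b h (γ s)) t) ∧
      ∀ ξ, covAccel (fun s => dualLift b h (γ s)) t ξ =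
        metricForm b (dualLift b h (γ t)) r ξ := by
  set c : ℝ → Quad V := fun s => dualLift b h (γ s) with hc
  have hB : (c t).IsPos := dualLift_isPos b h (γ t)
  obtain ⟨q, hq, -⟩ := exists_gram_eq_sandwich b hB (deriv c t)
  have hr : gram b (deriv (deriv c) t - q) = gram b (deriv (deriv c) t) -
        gram b (deriv c t) * (gram b (c t))⁻¹ * gram b (deriv c t) := by
    rw [map_sub, hq]
  have hacc : ∀ ξ, covAccel c t ξ = metricForm b (c t) (deriv (deriv c) t - q) ξ := by
    intro ξ
    have h0 : (gram b (c t)).det ≠ 0 := det_gram_dualLift_ne_zero b h (γ t)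
    rw [covAccel_eq h0, metricForm_apply, hr]
  refine ⟨deriv (deriv c) t - q, ?_, hr, hacc⟩
  -- Total geodesy only tests unimodular `ξ` normal to `h`. That is enough because the acceleration
  -- is itself a unimodular tangent.
  refine mem_of_forall_metricForm_eq_zero b hB (fun p hp => trace_eq_zero_of_mem_gaussMap hh hp) ?_
    fun ξ hξ hperp => ?_
  · rw [hr]
    exact (trace_inv_mul_deriv_curve b (contDiffAt_dualLift_comp hh hγ) one_ne_zero
      (Filter.Eventually.of_forall fun s => det_gram_dualLift b h _)).2
  · rw [← hacc]
    refine hgeod γ t hγ ξ ((isUnimodularTangent_iff hB ξ).2 hξ) fun v => ?_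
    rw [invMetric_eq (det_gram_dualLift_ne_zero b h (γ t)), ← metricForm_apply]
    exact hperp _ ⟨v, rfl⟩

/-- The positive tensor is `B⁻¹`: its pairing with a tangent vector is the logarithmic derivative of
`det B`, which is constant. -/
theorem isMixed_gaussMap (hh : IsSymImmersion d b h) (x : M) : IsMixed (gaussMap hh x).1 := by
  obtain ⟨hpos, -, p, -, hpq, hqp⟩ := dualLift_spec b h x
  have hpq' : ∀ v, SymTensor.toMap p (Quad.toMap (dualLift b h x) v) = v := fun v =>
    congrArg (fun f => f v) hpq
  have hqp' : ∀ α, Quad.toMap (dualLift b h x) (SymTensor.toMap p α) = α := fun α =>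
    congrArg (fun f => f α) hqp
  refine ⟨p, fun α hα => ?_, fun ξ hξ => ?_⟩
  · have hne : SymTensor.toMap p α ≠ 0 := by
      intro h0
      apply hα
      rw [← hqp' α, h0, map_zero]
    have := hpos _ hne
    rwa [hqp'] at this
  · have hinv : (Quad.toMap (dualLift b h x)).inverse = SymTensor.toMap p :=
      ContinuousLinearMap.inverse_eq hqp hpq
    have h1 := trace_eq_zero_of_mem_gaussMap hh hξ
    rw [← trace_inverse_comp (det_gram_dualLift_ne_zero b h x), hinv] at h1
    exact h1

/-- The derivative in the direction `v` is evaluated at the element `D v` defined by the same `v`: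
then `D²B(v, v) = r + q`, with `r` in the pencil by total geodesy and `q` the form `(D v) B⁻¹ (D
v)`, positive because `D v` is non-degenerate. -/
theorem exists_pos_grDeriv_eq (hgeod : IsTotallyGeodesic d b h) (hh : IsSymImmersion d b h)
    (hreg : ∀ x, IsRegularPencil (gaussMap hh x).1) (x : M) {C : Submodule ℝ (Quad V)}
    (hC : IsCompl (gaussMap hh x).1 C) {v : EuclideanSpace ℝ (Fin d)} (hv : v ≠ 0) :
    ∃ (q : Quad V) (y : (gaussMap hh x).1), q.IsPos ∧
      grDeriv (gaussMap hh) x C v y = (gaussMap hh x).1.mkQ q := by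
  have hx : x = (extChartAt (𝓡 d) x).symm (extChartAt (𝓡 d) x x + (0 : ℝ) • v) := by
    rw [zero_smul, add_zero, extChartAt_to_inv]
  obtain ⟨r, hr, hgr, -⟩ := hgeod.exists_accel hh (contMDiffAt_chart_line x v)
  rw [localLift_line, (deriv_localLift_line hh x v).1, (deriv_localLift_line hh x v).2, ← hx] at hgr
  rw [← hx] at hr
  set D := fderiv ℝ (localLift b h x) (extChartAt (𝓡 d) x x) with hD
  have hmem : D v ∈ (gaussMap hh x).1 := by
    rw [gaussMap_eq_range]
    exact ⟨v, rfl⟩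
  have hne : D v ≠ 0 := by
    intro h0
    apply hv
    apply injective_fderiv_localLift hh x (mem_extChartAt_target x)
    rw [map_zero]
    exact h0
  obtain ⟨q, hq, hqpos⟩ := exists_gram_eq_sandwich b (dualLift_isPos b h x) (D v)
  refine ⟨q, ⟨D v, hmem⟩, hqpos (hreg x _ hmem hne), ?_⟩
  rw [grDeriv_gaussMap hh x hC v v ⟨D v, hmem⟩ rfl]
  have hsum : fderiv ℝ (fderiv ℝ (localLift b h x)) (extChartAt (𝓡 d) x x) v v = r + q := by
    apply gram_injective b
    rw [map_add, hgr, hq, sub_add_cancel]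
  rw [hsum, map_add]
  have h0 : (gaussMap hh x).1.mkQ r = 0 := by
    rwa [Submodule.mkQ_apply, Submodule.Quotient.mk_eq_zero]
  rw [h0, zero_add]

/-- A positive quadric has positive pairing with the positive tensor that annihilates the pencil, so
it cannot belong to the pencil. -/
theorem IsMixed.mkQ_ne_zero [Nontrivial V] {P : Submodule ℝ (Quad V)} (hP : IsMixed P) {q : Quad V}
    (hq : q.IsPos) : P.mkQ q ≠ 0 := by
  obtain ⟨p, hp, hann⟩ := hP
  intro h0
  rw [Submodule.mkQ_apply, Submodule.Quotient.mk_eq_zero] at h0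
  have hp0 : p ≠ 0 := by
    rintro rfl
    obtain ⟨v, hv⟩ := exists_ne (0 : V)
    have h1 : Quad.toMap q v ≠ 0 := fun h2 => by
      have := hq v hv
      rw [h2] at this
      simp at this
    have := hp _ h1
    simp at this
  exact (quadPairing_pos hq hp.isSemiPos hp0).ne' (hann q h0)

theorem nontrivial_of_posProj (l : PosProj V) : Nontrivial V := by
  by_contra hV
  rw [not_nontrivial_iff_subsingleton] at hV
  exact l.1.rep_nonzero (Subtype.ext (by ext; exact Subsingleton.elim _ _))

theorem grDeriv_sub {Q : Type*} [NormedAddCommGroup Q] [NormedSpace ℝ Q] (u : M → Gr Q d) (x : M)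
    (C : Submodule ℝ Q) (v w : TangentSpace (𝓡 d) x) :
    grDeriv u x C (v - w) = grDeriv u x C v - grDeriv u x C w := by
  let D : EuclideanSpace ℝ (Fin d) →L[ℝ] ((u x).1 →L[ℝ] C) :=
    mfderiv (𝓡 d) 𝓘(ℝ, (u x).1 →L[ℝ] C) (fun y => grCoord (u x).1 C (u y).1) x
  have hD : D (v - w) = D v - D w := D.map_sub v w
  ext y
  change (u x).1.mkQ (D (v - w) y : Q) = (u x).1.mkQ (D v y : Q) - (u x).1.mkQ (D w y : Q)
  rw [hD, ← map_sub]
  rfl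

theorem isFittingImmersion_gaussMap (hgeod : IsTotallyGeodesic d b h) (hh : IsSymImmersion d b h)
    (hreg : ∀ x, IsRegularPencil (gaussMap hh x).1) : IsFittingImmersion (gaussMap hh) where
  smoothAt := grSmoothAt_gaussMap hh
  mixed := isMixed_gaussMap hh
  immersion := by
    intro x C hC
    have := nontrivial_of_posProj (h x)
    intro v w hvw
    by_contra hne
    obtain ⟨q, y, hq, hy⟩ := exists_pos_grDeriv_eq hgeod hh hreg x hC (sub_ne_zero.2 hne)
    refine (isMixed_gaussMap hh x).mkQ_ne_zero hq ?_
    rw [← hy]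
    have h2 := DFunLike.congr_fun (grDeriv_sub (gaussMap hh) x C v w) y
    rw [hvw, sub_self] at h2
    exact h2
  fitting := by
    intro x C hC v hv
    obtain ⟨q, y, hq, hy⟩ := exists_pos_grDeriv_eq hgeod hh hreg x hC hv
    exact ⟨q, hq, y, hy⟩

end TotallyGeodesic

/-! ### The ambient exponential map -/

section MatrixGeodExp

variable {ι : Type*} [Fintype ι] [DecidableEq ι]

/-- The exponential map of the space of positive definite matrices at `Rᵀ R`. -/
def geodExp (R X : Matrix ι ι ℝ) : Matrix ι ι ℝ :=
  Rᵀ * NormedSpace.exp ((R⁻¹)ᵀ * X * R⁻¹) * R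

theorem transpose_conj_of_symm {R X : Matrix ι ι ℝ} (hX : Xᵀ = X) :
    ((R⁻¹)ᵀ * X * R⁻¹)ᵀ = (R⁻¹)ᵀ * X * R⁻¹ := by
  rw [Matrix.transpose_mul, Matrix.transpose_mul, hX, Matrix.transpose_transpose, Matrix.mul_assoc]

theorem eq_zero_of_conj_eq_zero {R : Matrix ι ι ℝ} (hR : IsUnit R) {X : Matrix ι ι ℝ}
    (h : (R⁻¹)ᵀ * X * R⁻¹ = 0) : X = 0 := by
  have hu1 : IsUnit R⁻¹ := (Matrix.isUnit_nonsing_inv_iff).2 hR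
  have hu2 : IsUnit (R⁻¹)ᵀ := (Matrix.isUnit_transpose _).2 hu1
  rwa [hu1.mul_left_eq_zero, hu2.mul_right_eq_zero] at h

/-- The right side is what the geodesic equation yields; the definition exponentiates a symmetric
matrix instead, so that the spectral estimates apply. -/
theorem geodExp_eq {R : Matrix ι ι ℝ} (hR : IsUnit R) (X : Matrix ι ι ℝ) :
    geodExp R X = Rᵀ * R * NormedSpace.exp ((Rᵀ * R)⁻¹ * X) := by
  have hd : IsUnit R.det := (Matrix.isUnit_iff_isUnit_det R).1 hR
  have h1 : (Rᵀ * R)⁻¹ * X = R⁻¹ * ((R⁻¹)ᵀ * X * R⁻¹) * R := by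
    rw [Matrix.mul_inv_rev, Matrix.transpose_nonsing_inv]
    simp only [Matrix.mul_assoc]
    rw [Matrix.nonsing_inv_mul _ hd, Matrix.mul_one]
  rw [h1, Matrix.exp_conj' _ _ hR, geodExp]
  simp only [Matrix.mul_assoc]
  rw [← Matrix.mul_assoc R R⁻¹, Matrix.mul_nonsing_inv _ hd, Matrix.one_mul]

theorem geodExp_injOn {R : Matrix ι ι ℝ} (hR : IsUnit R) {X Y : Matrix ι ι ℝ} (hX : Xᵀ = X)
    (hY : Yᵀ = Y) (h : geodExp R X = geodExp R Y) : X = Y := by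
  have hT : IsUnit Rᵀ := (Matrix.isUnit_transpose _).2 hR
  have h1 := Matrix.exp_injOn_symm (transpose_conj_of_symm hX) (transpose_conj_of_symm hY)
    (hT.mul_left_cancel (hR.mul_right_cancel h))
  rw [← sub_eq_zero] at h1 ⊢
  apply eq_zero_of_conj_eq_zero hR
  rw [Matrix.mul_sub, Matrix.sub_mul, h1]

/-- Conjugation by `R` as a continuous linear map. -/
def conjL (P R : Matrix ι ι ℝ) : Matrix ι ι ℝ →L[ℝ] Matrix ι ι ℝ :=
  ContinuousLinearMap.mulLeftRight ℝ (Matrix ι ι ℝ) P R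

theorem conjL_apply (P R X : Matrix ι ι ℝ) : conjL P R X = P * X * R := rfl

theorem contDiff_geodExp (R : Matrix ι ι ℝ) : ContDiff ℝ ∞ (geodExp R) := by
  have h : geodExp R = conjL Rᵀ R ∘ NormedSpace.exp ∘ conjL (R⁻¹)ᵀ R⁻¹ := rfl
  rw [h]
  exact (conjL Rᵀ R).contDiff.comp (Matrix.contDiff_exp.comp (conjL (R⁻¹)ᵀ R⁻¹).contDiff)

theorem fderiv_geodExp_injOn {R : Matrix ι ι ℝ} (hR : IsUnit R) {X H : Matrix ι ι ℝ} (hX : Xᵀ = X)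
    (h : fderiv ℝ (geodExp R) X H = 0) : H = 0 := by
  have h1 : HasFDerivAt (NormedSpace.exp ∘ conjL (R⁻¹)ᵀ R⁻¹)
      ((fderiv ℝ NormedSpace.exp (conjL (R⁻¹)ᵀ R⁻¹ X)).comp (conjL (R⁻¹)ᵀ R⁻¹)) X :=
    (Matrix.contDiff_exp.differentiable (by simp) _).hasFDerivAt.comp X
      (conjL (R⁻¹)ᵀ R⁻¹).hasFDerivAt
  have h2 : HasFDerivAt (geodExp R) ((conjL Rᵀ R).comp
      ((fderiv ℝ NormedSpace.exp (conjL (R⁻¹)ᵀ R⁻¹ X)).comp (conjL (R⁻¹)ᵀ R⁻¹))) X :=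
    (conjL Rᵀ R).hasFDerivAt.comp X h1
  rw [h2.fderiv] at h
  have h3 : Rᵀ * fderiv ℝ NormedSpace.exp ((R⁻¹)ᵀ * X * R⁻¹) ((R⁻¹)ᵀ * H * R⁻¹) * R = 0 := h
  have hT : IsUnit Rᵀ := (Matrix.isUnit_transpose _).2 hR
  rw [hR.mul_left_eq_zero, hT.mul_right_eq_zero] at h3
  exact eq_zero_of_conj_eq_zero hR (Matrix.fderiv_exp_injOn_symm (transpose_conj_of_symm hX) h3)

/-- Undoing the congruence, the two terms are the traces of `exp S` and `exp (-S)` with `S`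
symmetric. The bound depends only on the endpoint, which makes the exponential map proper. -/
theorem trace_sq_le_geodExp {R : Matrix ι ι ℝ} (hR : IsUnit R) {X : Matrix ι ι ℝ} (hX : Xᵀ = X) :
    (((R⁻¹)ᵀ * X * R⁻¹) * ((R⁻¹)ᵀ * X * R⁻¹)).trace ≤
      ((R⁻¹)ᵀ * geodExp R X * R⁻¹).trace + (R * (geodExp R X)⁻¹ * Rᵀ).trace := by
  have hd : IsUnit R.det := (Matrix.isUnit_iff_isUnit_det R).1 hR
  have hdT : IsUnit (Rᵀ).det := by rwa [Matrix.det_transpose]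
  have h1 : (R⁻¹)ᵀ * geodExp R X * R⁻¹ = NormedSpace.exp ((R⁻¹)ᵀ * X * R⁻¹) := by
    rw [geodExp, Matrix.transpose_nonsing_inv]
    simp only [Matrix.mul_assoc]
    rw [Matrix.mul_nonsing_inv _ hd, Matrix.mul_one, ← Matrix.mul_assoc, Matrix.nonsing_inv_mul _ hdT,
      Matrix.one_mul]
  have h2 : R * (geodExp R X)⁻¹ * Rᵀ = NormedSpace.exp (-((R⁻¹)ᵀ * X * R⁻¹)) := by
    rw [geodExp, Matrix.mul_inv_rev, Matrix.mul_inv_rev, Matrix.exp_neg]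
    simp only [Matrix.mul_assoc]
    rw [Matrix.nonsing_inv_mul _ hdT, Matrix.mul_one, ← Matrix.mul_assoc R,
      Matrix.mul_nonsing_inv _ hd, Matrix.one_mul]
  rw [h1, h2]
  have h3 := Matrix.trace_exp_add_trace_exp_neg_ge (transpose_conj_of_symm (R := R) hX)
  have h4 : (0 : ℝ) ≤ Fintype.card ι := by positivity
  linarith

theorem sq_apply_le_trace {S : Matrix ι ι ℝ} (hS : Sᵀ = S) (i j : ι) :
    (S i j) ^ 2 ≤ (S * S).trace := by
  have h1 : (S * S).trace = ∑ k, ∑ l, (S k l) ^ 2 := by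
    simp only [Matrix.trace, Matrix.diag_apply, Matrix.mul_apply]
    refine Finset.sum_congr rfl fun k _ => Finset.sum_congr rfl fun l _ => ?_
    have : S l k = S k l := congrFun (congrFun hS k) l
    rw [this, sq]
  rw [h1]
  calc (S i j) ^ 2 ≤ ∑ l, (S i l) ^ 2 :=
        Finset.single_le_sum (f := fun l => (S i l) ^ 2) (fun l _ => sq_nonneg _) (Finset.mem_univ j)
    _ ≤ _ := Finset.single_le_sum (f := fun k => ∑ l, (S k l) ^ 2)
        (fun k _ => Finset.sum_nonneg fun l _ => sq_nonneg _) (Finset.mem_univ i)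

end MatrixGeodExp

/-! ### A criterion for closed range -/

section ClosedRange

/-- Near a point outside the range, `g` is bounded, so any preimages of nearby points lie in one
closed ball, whose image is compact and misses the point. -/
theorem isClosed_range_of_norm_le {F M : Type*} [NormedAddCommGroup F] [NormedSpace ℝ F]
    [FiniteDimensional ℝ F] [TopologicalSpace M] [T2Space M] {E : F → M} (hE : Continuous E)
    {g : M → ℝ} (hg : Continuous g) (h : ∀ v, ‖v‖ ≤ g (E v)) : IsClosed (Set.range E) := by
  have := FiniteDimensional.proper ℝ F
  rw [← isOpen_compl_iff, isOpen_iff_mem_nhds]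
  intro y hy
  have hK : IsClosed (E '' Metric.closedBall 0 (g y + 1)) :=
    ((isCompact_closedBall 0 (g y + 1)).image hE).isClosed
  have h1 : ∀ᶠ z in 𝓝 y, z ∉ E '' Metric.closedBall 0 (g y + 1) :=
    hK.isOpen_compl.mem_nhds fun ⟨v, _, hv⟩ => hy ⟨v, hv⟩
  have h2 : ∀ᶠ z in 𝓝 y, g z < g y + 1 := hg.continuousAt.eventually_lt_const (by linarith)
  filter_upwards [h1, h2] with z hz1 hz2
  rintro ⟨v, rfl⟩
  exact hz1 ⟨v, by simpa using (h v).trans hz2.le, rfl⟩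

end ClosedRange

/-! ### Geodesics of the submanifold as ambient geodesics -/

section CompleteImmersions

variable {V : Type*} [NormedAddCommGroup V] [NormedSpace ℝ V] [FiniteDimensional ℝ V]
  {n : ℕ} {b : Module.Basis (Fin (2 * n)) ℝ V}
  {d : ℕ} {M : Type*} [TopologicalSpace M]
  [ChartedSpace (EuclideanSpace ℝ (Fin d)) M] [IsManifold (𝓡 d) ∞ M]
  {h : M → PosProj V}

/-- The geodesic equation in the symmetric space, for the geodesics of a totally geodesic
submanifold. -/
theorem IsInducedGeodesic.hasDerivAt_deriv {γ : ℝ → M} (hγ : IsInducedGeodesic d b h γ)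
    (hgeod : IsTotallyGeodesic d b h) (hh : IsSymImmersion d b h) (t : ℝ) :
    HasDerivAt (fun s => gram b (dualLift b h (γ s)))
        (gram b (deriv (fun s => dualLift b h (γ s)) t)) t ∧
      HasDerivAt (fun s => gram b (deriv (fun s => dualLift b h (γ s)) s))
        (gram b (deriv (fun s => dualLift b h (γ s)) t) * (gram b (dualLift b h (γ t)))⁻¹ *
          gram b (deriv (fun s => dualLift b h (γ s)) t)) t := by
  set c : ℝ → Quad V := fun s => dualLift b h (γ s) with hc
  have hcs : ContDiffAt ℝ ∞ c t := contDiffAt_dualLift_comp hh (hγ.1 t)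
  have hd1 : HasDerivAt c (deriv c t) t := (hcs.differentiableAt (by simp)).hasDerivAt
  have hd2 : HasDerivAt (deriv c) (deriv (deriv c) t) t :=
    (hcs.deriv_top.differentiableAt (by simp)).hasDerivAt
  refine ⟨(gram b).hasFDerivAt.comp_hasDerivAt t hd1, ?_⟩
  obtain ⟨r, ⟨v, rfl⟩, hgr, hacc⟩ := hgeod.exists_accel hh (hγ.1 t)
  -- The acceleration is tangent to `M` by total geodesy and orthogonal to `M` by the induced
  -- geodesic equation; paired with itself it gives zero.
  have h0 : (dualDeriv d b h (γ t)) v = 0 := by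
    apply metricForm_self_pos b (dualLift_isPos b h (γ t))
    have h1 := hacc (dualDeriv d b h (γ t) v)
    rw [hγ.2 t v] at h1
    exact h1.symm.le
  have h2 : gram b (deriv (deriv c) t) =
      gram b (deriv c t) * (gram b (c t))⁻¹ * gram b (deriv c t) := by
    rw [← sub_eq_zero, ← map_zero (gram b), ← h0]
    exact hgr.symm
  have h3 := (gram b).hasFDerivAt.comp_hasDerivAt t hd2
  rw [h2] at h3
  exact h3

theorem IsCompleteImmersion.exists_geodesic (hcomp : IsCompleteImmersion d b h)
    (hh : IsSymImmersion d b h) (x : M) (v : EuclideanSpace ℝ (Fin d)) :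
    ∃ γ : ℝ → M, IsInducedGeodesic d b h γ ∧ γ 0 = x ∧
      deriv (fun s => dualLift b h (γ s)) 0 = dualDeriv d b h x v := by
  obtain ⟨γ, hγ, hX⟩ := hcomp ⟨x, v⟩
  refine ⟨γ, hγ, congrArg (fun X : TangentBundle (𝓡 d) M => X.1) hX, ?_⟩
  have h1 := hasDerivAt_dualLift_comp hh ((hγ.1 0).mdifferentiableAt (by simp))
  rw [h1.deriv]
  exact congrArg (fun X : TangentBundle (𝓡 d) M => dualDeriv d b h X.1 X.2) hX

theorem gram_geodesic {R : Matrix (Fin (2 * n)) (Fin (2 * n)) ℝ} {γ : ℝ → M}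
    (hγ : IsInducedGeodesic d b h γ) (hgeod : IsTotallyGeodesic d b h)
    (hh : IsSymImmersion d b h) (hR : gram b (dualLift b h (γ 0)) = Rᵀ * R) (hu : IsUnit R) (t : ℝ) :
    gram b (dualLift b h (γ t)) =
        geodExp R (t • gram b (deriv (fun s => dualLift b h (γ s)) 0)) ∧
      gram b (deriv (fun s => dualLift b h (γ s)) t) = gram b (dualLift b h (γ t)) *
        ((gram b (dualLift b h (γ 0)))⁻¹ * gram b (deriv (fun s => dualLift b h (γ s)) 0)) := by
  obtain ⟨h1, h2⟩ := eq_mul_exp_of_geodesic (fun t => (hγ.hasDerivAt_deriv hgeod hh t).1)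
    (fun t => (hγ.hasDerivAt_deriv hgeod hh t).2) (fun t => det_gram_dualLift_ne_zero b h (γ t)) t
  refine ⟨?_, h2⟩
  rw [h1, geodExp_eq hu, hR, Matrix.mul_smul]

end CompleteImmersions

/-! ### Local inverses of immersions -/

section LocalDiffeo

/-- Composing `β` with a linear left inverse of `β'` gives a map with derivative the identity, to
which the inverse function theorem applies. -/
theorem HasStrictFDerivAt.exists_local_leftInverse {F W : Type*} [NormedAddCommGroup F]
    [NormedSpace ℝ F] [FiniteDimensional ℝ F] [NormedAddCommGroup W] [NormedSpace ℝ W]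
    [FiniteDimensional ℝ W] {β : F → W} {z₀ : F} {β' : F →L[ℝ] W} (hβ : HasStrictFDerivAt β β' z₀)
    (hβ' : Function.Injective β') :
    ∃ (σ : W → F) (σ' : W →L[ℝ] F), HasStrictFDerivAt σ σ' (β z₀) ∧
      ∀ᶠ z in 𝓝 z₀, σ (β z) = z := by
  have : CompleteSpace F := FiniteDimensional.complete ℝ F
  obtain ⟨π₀, hπ₀⟩ := LinearMap.exists_leftInverse_of_injective (β' : F →ₗ[ℝ] W)
    (LinearMap.ker_eq_bot.2 hβ')
  let π : W →L[ℝ] F := LinearMap.toContinuousLinearMap π₀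
  have hπ : π.comp β' = ContinuousLinearMap.id ℝ F := by
    ext v
    exact LinearMap.congr_fun hπ₀ v
  have hψ : HasStrictFDerivAt (fun z => π (β z)) ((ContinuousLinearEquiv.refl ℝ F : F ≃L[ℝ] F) :
      F →L[ℝ] F) z₀ := by
    have := π.hasStrictFDerivAt.comp z₀ hβ
    rw [hπ] at this
    exact this
  exact ⟨fun w => hψ.localInverse _ _ _ (π w), _,
    hψ.to_localInverse.comp (β z₀) π.hasStrictFDerivAt, hψ.eventually_left_inverse⟩

/-- A continuous map `e` whose composition with an immersion `β` is an immersion `φ` of the same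
dimension is open at `v₀`. -/
theorem map_nhds_eq_of_immersion_comp {F W : Type*} [NormedAddCommGroup F] [NormedSpace ℝ F]
    [FiniteDimensional ℝ F] [NormedAddCommGroup W] [NormedSpace ℝ W] [FiniteDimensional ℝ W]
    {e : F → F} {β φ : F → W} {v₀ : F} {β' φ' : F →L[ℝ] W} (he : ContinuousAt e v₀)
    (hβ : HasStrictFDerivAt β β' (e v₀)) (hφ : HasStrictFDerivAt φ φ' v₀)
    (hβ' : Function.Injective β') (hφ' : Function.Injective φ')
    (hcomp : ∀ᶠ v in 𝓝 v₀, β (e v) = φ v) : Filter.map e (𝓝 v₀) = 𝓝 (e v₀) := by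
  have : CompleteSpace F := FiniteDimensional.complete ℝ F
  obtain ⟨σ, σ', hσ, hleft⟩ := hβ.exists_local_leftInverse hβ'
  -- Continuity of `e` keeps it where `σ` inverts `β`; so `e` is locally `σ ∘ φ`, hence strictly
  -- differentiable.
  have h1 : ∀ᶠ v in 𝓝 v₀, σ (φ v) = e v := by
    filter_upwards [hcomp, he.eventually hleft] with v hv hv'
    rw [← hv]
    exact hv'
  have h2 : HasStrictFDerivAt e (σ'.comp φ') v₀ := by
    rw [hcomp.self_of_nhds] at hσ
    exact (hσ.comp v₀ hφ).congr_of_eventuallyEq h1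
  have h5 : β'.comp (σ'.comp φ') = φ' := by
    have h6 : HasFDerivAt (fun v => β (e v)) (β'.comp (σ'.comp φ')) v₀ :=
      hβ.hasFDerivAt.comp v₀ h2.hasFDerivAt
    exact h6.unique (hφ.hasFDerivAt.congr_of_eventuallyEq hcomp)
  have h7 : Function.Injective (σ'.comp φ') := by
    intro v w hvw
    apply hφ'
    rw [← h5]
    exact congrArg β' hvw
  have h9 : Function.Surjective ((σ'.comp φ' : F →L[ℝ] F) : F →ₗ[ℝ] F) :=
    LinearMap.injective_iff_surjective.1 h7
  exact h2.map_nhds_eq_of_surj (LinearMap.range_eq_top.2 h9)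

end LocalDiffeo

/-! ### Surjectivity of the exponential map and disjointness -/

section ExponentialMap

variable {V : Type*} [NormedAddCommGroup V] [NormedSpace ℝ V] [FiniteDimensional ℝ V]
  {n : ℕ} {b : Module.Basis (Fin (2 * n)) ℝ V}
  {d : ℕ} {M : Type*} [TopologicalSpace M]
  [ChartedSpace (EuclideanSpace ℝ (Fin d)) M] [IsManifold (𝓡 d) ∞ M]
  {h : M → PosProj V}

theorem continuous_dualLift (hh : IsSymImmersion d b h) : Continuous (dualLift b h) :=
  hh.smooth.continuous

theorem gram_fderiv_localLift_injective (hh : IsSymImmersion d b h) (x : M)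
    {z : EuclideanSpace ℝ (Fin d)} (hz : z ∈ (extChartAt (𝓡 d) x).target) :
    Function.Injective ((gram b).comp (fderiv ℝ (localLift b h x) z)) :=
  (gram_injective b).comp (injective_fderiv_localLift hh x hz)

theorem hasStrictFDerivAt_gram_localLift (hh : IsSymImmersion d b h) (x : M)
    {z : EuclideanSpace ℝ (Fin d)} (hz : z ∈ (extChartAt (𝓡 d) x).target) :
    HasStrictFDerivAt (fun z => gram b (localLift b h x z))
      ((gram b).comp (fderiv ℝ (localLift b h x) z)) z :=
  (gram b).hasStrictFDerivAt.comp z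
    ((contDiffAt_localLift hh x hz).hasStrictFDerivAt (by simp))

theorem exists_injOn_gram_dualLift (hh : IsSymImmersion d b h) (x : M) :
    ∃ u ∈ 𝓝 x, Set.InjOn (fun y => gram b (dualLift b h y)) u := by
  have hz := mem_extChartAt_target (I := 𝓡 d) x
  obtain ⟨σ, -, -, hσ⟩ := (hasStrictFDerivAt_gram_localLift hh x hz).exists_local_leftInverse
    (gram_fderiv_localLift_injective hh x hz)
  obtain ⟨s, hs, hinj⟩ : ∃ s ∈ 𝓝 (extChartAt (𝓡 d) x x),
      Set.InjOn (fun z => gram b (localLift b h x z)) s :=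
    ⟨_, hσ, fun z hz w hw hzw => by rw [← hz, ← hw]; exact congrArg σ hzw⟩
  refine ⟨(extChartAt (𝓡 d) x).source ∩ extChartAt (𝓡 d) x ⁻¹' s,
    Filter.inter_mem (extChartAt_source_mem_nhds x) (continuousAt_extChartAt x hs), ?_⟩
  rintro y ⟨hy, hys⟩ w ⟨hw, hws⟩ hyw
  apply (extChartAt (𝓡 d) x).injOn hy hw
  apply hinj hys hws
  simp only [localLift, (extChartAt (𝓡 d) x).left_inv hy, (extChartAt (𝓡 d) x).left_inv hw]
  exact hyw

/-- For a symmetric matrix, the trace of the square is the sum of the squared entries, and an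
injective linear map in finite dimension is bounded below. -/
theorem norm_le_of_trace_sq_le {F ι : Type*} [NormedAddCommGroup F] [NormedSpace ℝ F]
    [FiniteDimensional ℝ F] [Fintype ι] [DecidableEq ι] (L : F →L[ℝ] Matrix ι ι ℝ)
    (hinj : Function.Injective L) (hsymm : ∀ v, (L v)ᵀ = L v) :
    ∃ K : ℝ, 0 ≤ K ∧ ∀ v, ‖v‖ ≤ K * √((L v * L v).trace) := by
  let L₁ : F →ₗ[ℝ] ι → ι → ℝ := (Matrix.ofLinearEquiv ℝ).symm.toLinearMap ∘ₗ (L : F →ₗ[ℝ] _)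
  have hL₁ : ∀ v i j, L₁ v i j = L v i j := fun v i j => rfl
  have hinj₁ : LinearMap.ker L₁ = ⊥ :=
    LinearMap.ker_eq_bot.2 ((Matrix.ofLinearEquiv ℝ).symm.injective.comp hinj)
  obtain ⟨K, -, hK⟩ := L₁.exists_antilipschitzWith hinj₁
  refine ⟨K, K.2, fun v => (ZeroHomClass.bound_of_antilipschitz L₁ hK v).trans ?_⟩
  refine mul_le_mul_of_nonneg_left ?_ K.2
  rw [pi_norm_le_iff_of_nonneg (Real.sqrt_nonneg _)]
  intro i
  rw [pi_norm_le_iff_of_nonneg (Real.sqrt_nonneg _)]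
  intro j
  rw [hL₁]
  exact Real.abs_le_sqrt (sq_apply_le_trace (hsymm v) i j)

/-- A complete totally geodesic submanifold is geodesically connected. -/
theorem IsCompleteImmersion.exists_geodesic_joining [T2Space M] [ConnectedSpace M]
    (hcomp : IsCompleteImmersion d b h) (hgeod : IsTotallyGeodesic d b h)
    (hh : IsSymImmersion d b h) {x y : M} (hxy : x ≠ y) :
    ∃ γ : ℝ → M, IsInducedGeodesic d b h γ ∧ γ 0 = x ∧ γ 1 = y ∧
      deriv (fun s => dualLift b h (γ s)) 0 ≠ 0 := by
  obtain ⟨R, hR, hu⟩ := exists_conjTranspose_mul_self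
    ((gram_posDef_iff b _).2 (dualLift_isPos b h x))
  rw [Matrix.conjTranspose_eq_transpose_of_trivial] at hR
  choose γ₀ hγ₀ hγ0 hγd using hcomp.exists_geodesic hh x
  -- The geodesic chosen for `v = 0` is replaced by the constant path, as
  -- `continuous_endpoint_of_lift` asks.
  let γ : EuclideanSpace ℝ (Fin d) → ℝ → M := fun v => if v = 0 then fun _ => x else γ₀ v
  have hγz : ∀ t, γ 0 t = x := fun t => by simp [γ]
  have hγn : ∀ v, v ≠ 0 → γ v = γ₀ v := fun v hv => by simp [γ, hv]
  let ℓ : EuclideanSpace ℝ (Fin d) →L[ℝ] Matrix (Fin (2 * n)) (Fin (2 * n)) ℝ :=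
    (gram b).comp (dualDeriv d b h x)
  have hℓinj : Function.Injective ℓ := (gram_injective b).comp (hh.injective x)
  have hℓs : ∀ v, (ℓ v)ᵀ = ℓ v := fun v => gram_transpose b _
  have hBγ : ∀ v t, gram b (dualLift b h (γ v t)) = geodExp R (ℓ (t • v)) := by
    intro v t
    by_cases hv : v = 0
    · rw [hv, hγz, hR, smul_zero, map_zero, geodExp_eq hu, Matrix.mul_zero, NormedSpace.exp_zero,
        Matrix.mul_one]
    · have h1 := (gram_geodesic (hγ₀ v) hgeod hh (by rw [hγ0]; exact hR) hu t).1
      rw [hγn v hv, h1, hγd, map_smul]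
      rfl
  have hγc : ∀ v, Continuous (γ v) := by
    intro v
    by_cases hv : v = 0
    · rw [hv]
      exact (continuous_const (y := x)).congr fun t => (hγz t).symm
    · rw [hγn v hv]
      exact (hγ₀ v).1.continuous
  have hγx : ∀ v, γ v 0 = x := by
    intro v
    by_cases hv : v = 0
    · rw [hv, hγz]
    · rw [hγn v hv, hγ0]
  have hlc : LocallyCompactSpace M := Manifold.locallyCompact_of_finiteDimensional (𝓡 d)
  have hBc : Continuous fun y => gram b (dualLift b h y) :=
    (gram b).continuous.comp (continuous_dualLift hh)
  have hφd : ContDiff ℝ ∞ fun v => geodExp R (ℓ v) := (contDiff_geodExp R).comp ℓ.contDiff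
  have hφinj : Function.Injective fun v => geodExp R (ℓ v) := fun v w hvw =>
    hℓinj (geodExp_injOn hu (hℓs v) (hℓs w) hvw)
  set E : EuclideanSpace ℝ (Fin d) → M := fun v => γ v 1 with hE
  have hEc : Continuous E := continuous_endpoint_of_lift hBc (exists_injOn_gram_dualLift hh)
    hφd.continuous hφinj hγc hγx hγz hBγ
  have hBE : ∀ v, gram b (dualLift b h (E v)) = geodExp R (ℓ v) := fun v => by
    rw [hE, hBγ, one_smul]
  -- The norm of `v` is bounded by a continuous function of the endpoint `E v`, through
  -- `trace_sq_le_geodExp`.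
  have hclosed : IsClosed (Set.range E) := by
    obtain ⟨K, hK0, hK⟩ := norm_le_of_trace_sq_le ((conjL (R⁻¹)ᵀ R⁻¹).comp ℓ)
      (fun v w hvw => hℓinj (sub_eq_zero.1 (eq_zero_of_conj_eq_zero hu (by
        rw [← conjL_apply, map_sub, sub_eq_zero]
        exact hvw)))) (fun v => transpose_conj_of_symm (hℓs v))
    have hinv : Continuous fun y => (gram b (dualLift b h y))⁻¹ := by
      rw [continuous_iff_continuousAt]
      intro y
      exact ContinuousAt.comp (f := fun y => gram b (dualLift b h y)) (g := fun A => A⁻¹)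
        (Matrix.hasFDerivAt_inv (det_gram_dualLift_ne_zero b h y)).continuousAt hBc.continuousAt
    refine isClosed_range_of_norm_le hEc (g := fun y =>
      K * √(((R⁻¹)ᵀ * gram b (dualLift b h y) * R⁻¹).trace +
        (R * (gram b (dualLift b h y))⁻¹ * Rᵀ).trace)) ?_ fun v => (hK v).trans ?_
    · have h1 : Continuous fun y => ((R⁻¹)ᵀ * gram b (dualLift b h y) * R⁻¹).trace :=
        Matrix.traceL.continuous.comp ((conjL (R⁻¹)ᵀ R⁻¹).continuous.comp hBc)
      have h2 : Continuous fun y => (R * (gram b (dualLift b h y))⁻¹ * Rᵀ).trace :=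
        Matrix.traceL.continuous.comp ((conjL R Rᵀ).continuous.comp hinv)
      fun_prop
    · refine mul_le_mul_of_nonneg_left (Real.sqrt_le_sqrt ?_) hK0
      rw [hBE]
      exact trace_sq_le_geodExp hu (hℓs v)
  -- Read in a chart, `E` composed with the immersion `B` is the ambient exponential on the tangent
  -- space, an immersion of the same dimension; so `E` is open.
  have hopen : IsOpen (Set.range E) := by
    rw [isOpen_iff_mem_nhds]
    rintro _ ⟨v₀, rfl⟩
    set m := E v₀ with hm
    have hsrc : ∀ᶠ v in 𝓝 v₀, E v ∈ (extChartAt (𝓡 d) m).source :=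
      hEc.continuousAt.eventually (extChartAt_source_mem_nhds m)
    have hz : extChartAt (𝓡 d) m (E v₀) ∈ (extChartAt (𝓡 d) m).target := mem_extChartAt_target m
    have hmap := map_nhds_eq_of_immersion_comp (e := fun v => extChartAt (𝓡 d) m (E v))
      (ContinuousAt.comp (continuousAt_extChartAt m) hEc.continuousAt)
      (hasStrictFDerivAt_gram_localLift hh m hz)
      (((contDiff_geodExp R).contDiffAt.hasStrictFDerivAt (by simp)).comp v₀ ℓ.hasStrictFDerivAt)
      (gram_fderiv_localLift_injective hh m hz)
      (by
        rw [injective_iff_map_eq_zero]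
        intro v hv
        apply hℓinj
        rw [map_zero]
        exact fderiv_geodExp_injOn hu (hℓs v₀) hv)
      (by
        filter_upwards [hsrc] with v hv
        rw [localLift, (extChartAt (𝓡 d) m).left_inv hv, hBE])
    have h1 : (fun v => extChartAt (𝓡 d) m (E v)) '' {v | E v ∈ (extChartAt (𝓡 d) m).source} ∈
        𝓝 (extChartAt (𝓡 d) m m) := by
      have h2 := Filter.image_mem_map (m := fun v => extChartAt (𝓡 d) m (E v)) hsrc
      rw [hmap] at h2
      exact h2
    filter_upwards [extChartAt_source_mem_nhds (I := 𝓡 d) m, continuousAt_extChartAt m h1]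
      with w hw hw'
    obtain ⟨v, hv, hvw⟩ := hw'
    exact ⟨v, (extChartAt (𝓡 d) m).injOn hv hw hvw⟩
  have huniv : Set.range E = Set.univ :=
    IsClopen.eq_univ ⟨hclosed, hopen⟩ ⟨_, 0, rfl⟩
  obtain ⟨v, hv⟩ : y ∈ Set.range E := huniv ▸ Set.mem_univ y
  have hv0 : v ≠ 0 := by
    rintro rfl
    exact hxy ((hγz 1).symm.trans hv)
  refine ⟨γ₀ v, hγ₀ v, hγ0 v, ?_, ?_⟩
  · rw [← hγn v hv0]
    exact hv
  · rw [hγd]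
    intro h0
    exact hv0 (hh.injective x (h0.trans (map_zero _).symm))

/-- Along a geodesic, the pairing with a semi-positive tensor is strictly convex. -/
theorem strictMono_quadPairing_deriv (hgeod : IsTotallyGeodesic d b h)
    (hh : IsSymImmersion d b h) (hreg : ∀ x, IsRegularPencil (gaussMap hh x).1) {γ : ℝ → M}
    (hγ : IsInducedGeodesic d b h γ) (hne : deriv (fun s => dualLift b h (γ s)) 0 ≠ 0)
    {p : SymTensor V} (hp : p.IsSemiPos) (hp0 : p ≠ 0) :
    StrictMono fun t => quadPairing (deriv (fun s => dualLift b h (γ s)) t) p := by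
  obtain ⟨R, hR, hu⟩ := exists_conjTranspose_mul_self
    ((gram_posDef_iff b _).2 (dualLift_isPos b h (γ 0)))
  rw [Matrix.conjTranspose_eq_transpose_of_trivial] at hR
  apply strictMono_of_deriv_pos
  intro t
  have h1 := ((hγ.hasDerivAt_deriv hgeod hh t).2.const_mul (tensorMatrix b p))
  have h2 := Matrix.traceL.hasFDerivAt.comp_hasDerivAt t h1
  have h3 : (fun t => quadPairing (deriv (fun s => dualLift b h (γ s)) t) p) =
      Matrix.traceL ∘ fun t =>
        tensorMatrix b p * gram b (deriv (fun s => dualLift b h (γ s)) t) := by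
    funext t
    exact quadPairing_eq_trace b _ p
  have hmem : deriv (fun s => dualLift b h (γ s)) t ∈ (gaussMap hh (γ t)).1 := by
    rw [(hasDerivAt_dualLift_comp hh ((hγ.1 t).mdifferentiableAt (by simp))).deriv]
    exact ⟨_, rfl⟩
  -- The velocity is `C(t) C(0)⁻¹ C'(0)` with invertible factors before `C'(0)`, so it never
  -- vanishes if it does not at time zero.
  have hnet : deriv (fun s => dualLift b h (γ s)) t ≠ 0 := by
    intro h0
    have h4 := (gram_geodesic hγ hgeod hh hR hu t).2
    rw [h0, map_zero] at h4
    have hut : IsUnit (gram b (dualLift b h (γ t))) :=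
      ((gram_posDef_iff b _).2 (dualLift_isPos b h (γ t))).isUnit
    have hu0 : IsUnit (gram b (dualLift b h (γ 0)))⁻¹ :=
      Matrix.isUnit_nonsing_inv_iff.2 ((gram_posDef_iff b _).2 (dualLift_isPos b h (γ 0))).isUnit
    have h5 := hut.mul_right_eq_zero.1 h4.symm
    rw [hu0.mul_right_eq_zero] at h5
    exact hne (gram_injective b (h5.trans (map_zero _).symm))
  obtain ⟨q, hq, hqpos⟩ := exists_gram_eq_sandwich b (dualLift_isPos b h (γ t))
    (deriv (fun s => dualLift b h (γ s)) t)
  rw [h3, h2.deriv, ← hq, Matrix.traceL_apply, ← quadPairing_eq_trace]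
  exact quadPairing_pos (hqpos (hreg _ _ hmem hnet)) hp hp0

theorem exists_inAnnihilator_of_not_disjoint {P P' : Submodule ℝ (Quad V)}
    (hPP' : ¬ Disjoint (projSlice P) (projSlice P')) :
    ∃ p : SymTensor V, p ≠ 0 ∧ p.IsSemiPos ∧ InAnnihilator P p ∧ InAnnihilator P' p := by
  rw [Set.not_disjoint_iff] at hPP'
  obtain ⟨l, ⟨p, hp0, hpl, hps, hpP⟩, ⟨p', hp0', hpl', -, hpP'⟩⟩ := hPP'
  refine ⟨p, hp0, hps, hpP, fun q hq => ?_⟩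
  obtain ⟨a, rfl⟩ : ∃ a : ℝ, p = a • p' := by
    induction l using Projectivization.ind with
    | h z hz =>
      rw [Projectivization.submodule_mk] at hpl hpl'
      obtain ⟨c, rfl⟩ := Submodule.mem_span_singleton.1 hpl
      obtain ⟨c', rfl⟩ := Submodule.mem_span_singleton.1 hpl'
      have hc' : c' ≠ 0 := by
        rintro rfl
        simp at hp0'
      exact ⟨c / c', by rw [smul_smul, div_mul_cancel₀ _ hc']⟩
  have h1 : quadPairing q (a • p') = a * quadPairing q p' := by
    classical
    let e := Module.finBasis ℝ V
    have h2 : tensorMatrix e (a • p') = a • tensorMatrix e p' := by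
      ext i j
      simp [tensorMatrix]
    rw [quadPairing_eq_trace e, quadPairing_eq_trace e, h2]
    simp
  rw [h1, hpP' q hq, mul_zero]

theorem isGloballyFitting_gaussMap [T2Space M] [ConnectedSpace M]
    (hcomp : IsCompleteImmersion d b h) (hgeod : IsTotallyGeodesic d b h)
    (hh : IsSymImmersion d b h) (hreg : ∀ x, IsRegularPencil (gaussMap hh x).1) :
    IsGloballyFitting (gaussMap hh) where
  continuousAt := fun x C hC => by
    obtain ⟨h1, h2⟩ := grSmoothAt_gaussMap hh x C hC
    exact ⟨h1, h2.continuousAt⟩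
  mixed := isMixed_gaussMap hh
  disjoint := by
    intro x y hxy
    by_contra hdisj
    obtain ⟨p, hp0, hp, hpx, hpy⟩ := exists_inAnnihilator_of_not_disjoint hdisj
    obtain ⟨γ, hγ, h0, h1, hne⟩ := hcomp.exists_geodesic_joining hgeod hh hxy
    have hmono := strictMono_quadPairing_deriv hgeod hh hreg hγ hne hp hp0
    have hmem : ∀ t, deriv (fun s => dualLift b h (γ s)) t ∈ (gaussMap hh (γ t)).1 := by
      intro t
      rw [(hasDerivAt_dualLift_comp hh ((hγ.1 t).mdifferentiableAt (by simp))).deriv]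
      exact ⟨_, rfl⟩
    -- The velocities at the two ends lie in the pencils at `x` and `y`, so their pairings with `p`
    -- are both zero, against strict monotonicity.
    have h2 := hpx _ (h0 ▸ hmem 0)
    have h3 := hpy _ (h1 ▸ hmem 1)
    have h4 := hmono (zero_lt_one' ℝ)
    simp only [h2, h3, lt_irrefl] at h4

end ExponentialMap

end

theorem proposition7p1 {V : Type*} [NormedAddCommGroup V] [NormedSpace ℝ V]
    [FiniteDimensional ℝ V] {n : ℕ} (b : Module.Basis (Fin (2 * n)) ℝ V)
    {d : ℕ} {M : Type*} [TopologicalSpace M] [T2Space M] [SecondCountableTopology M]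
    [ConnectedSpace M] [ChartedSpace (EuclideanSpace ℝ (Fin d)) M] [IsManifold (𝓡 d) ∞ M]
    (h : M → PosProj V) (hh : IsSymImmersion d b h) (hgeod : IsTotallyGeodesic d b h)
    (hreg : ∀ x, IsRegularPencil (gaussMap hh x).1) :
    IsFittingImmersion (gaussMap hh) ∧
      (IsCompleteImmersion d b h → IsGloballyFitting (gaussMap hh)) := by
  exact ⟨isFittingImmersion_gaussMap hgeod hh hreg, fun hcomp =>
    isGloballyFitting_gaussMap hcomp hgeod hh hreg⟩
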